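/- Let $d\ge 0$ be an integer and let $\rho_0,\rho_1:\mathbb R^d\to[0,\infty)$ be (measurable) probability densities such that $\rho_0$ is bounded, $\rho_1$ is continuous, and $\int\|x\|\rho_1(x)\,dx<\infty$. For $\sigma\ge 0$ let $\phi^\sigma_{t,x_1}(x_0)=(1-t)x_0+tx_1+\sigma t x_0$ be the (regularized, if $\sigma>0$) linear conditional flow. At the times at which it is invertible ($0\le t<1$ if $\sigma=0$, and $0\le t\le 1$ if $\sigma>0$) put $$w^\sigma(t,x_1,x)=\partial_s\phi^\sigma_{s,x_1}\bigl((\phi^\sigma_{t,x_1})^{-1}(x)\bigr)\Big|_{s=t},\qquad \rho^\sigma_{x_1}(x,t)=\rho_0\bigl((\phi^\sigma_{t,x_1})^{-1}(x)\bigr)\,\bigl|\det\partial_x(\phi^\sigma_{t,x_1})^{-1}(x)\bigr|,$$ $$\rho^\sigma(x,t)=\int\rho^\sigma_{x_1}(x,t)\rho_1(x_1)\,dx_1 ,$$ and for $\sigma=0$ let $\rho=\rho^0$ and let $$\overline v(x,t)=\int w^0(t,x_1,x)\,\frac{\rho^0_{x_1}(x,t)\rho_1(x_1)}{\rho(x,t)}\,dx_1$$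 be the marginal vector field (equal to $0$ where $\rho(x,t)=0$). Let $$v(x,t)=\frac{\int (x_1-x)\,\rho_0\bigl(\frac{x-x_1t}{1-t}\bigr)\rho_1(x_1)\,dx_1}{(1-t)\int\rho_0\bigl(\frac{x-x_1t}{1-t}\bigr)\rho_1(x_1)\,dx_1},\qquad 0\le t<1,$$ again read as $0$ where the denominator vanishes. Then the following hold. 1. For $0\le t<1$, $\rho(\cdot,t)$ is a probability density, and $\rho(x,0)=\rho_0(x)$ for all $x$. The pair $(\rho,\overline v)$ is a weak solution of $$\partial_t\rho=-\operatorname{div}(\rho\,\overline v),\qquad \rho(\cdot,0)=\rho_0,\quad \rho(\cdot,1)=\rho_1,$$ that is, $\rho$ and $\rho\,\overline v$ are integrable on $K\times[0,1]$ for every compact $K\subset\mathbb R^d$, and for every $\psi\in C_c^\infty(\mathbb R^d\times\mathbb R)$ $$\int_0^1\!\!\int\bigl(\rho\,\partial_t\psi+\langle\rho\,\overline v,\nabla_x\psi\rangle\bigr)\,dx\,dt=\int\psi(x,1)\rho_1(x)\,dx-\int\psi(x,0)\rho_0(x)\,dx .$$ 2. If moreover $\rho_0$ is $C^1$ with bounded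 gradient, then the continuity equation holds classically at every point of $\mathbb R^d\times(0,1)$, and $\rho(x,t)\to\rho_0(x)$ as $t\to0^+$ for every $x$. 3. If $\rho_1$ is bounded or $\|y\|^d\rho_0(y)\to0$ as $\|y\|\to\infty$ (for instance if $\rho_0$ is Gaussian), then for every $x$ $$\lim_{t\to1^-}\rho(x,t)=\rho_1(x)\qquad\text{and}\qquad \lim_{\sigma\to0^+}\rho^\sigma(x,1)=\rho_1(x).$$ 4. $v(x,t)=\overline v(x,t)$ for all $x$ and all $0\le t<1$. For every $p>0$ (in particular for $p=1$ and for $p=2$) the explicit field $v$ minimizes, over all vector fields $u:\mathbb R^d\times[0,1]\to\mathbb R^d$, the Flow Matching objective $$u\mapsto \mathbb E_{t\sim\mathcal U[0,1]}\,\mathbb E_{x\sim\rho(\cdot,t)}\,\|\overline v(x,t)-u(x,t)\|^p\in[0,\infty],$$ and the minimum value is $0$. -/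

import Mathlib

open MeasureTheory Filter Topology Set
open scoped ContDiff ENNReal

namespace ExFM

/-- `ℝ^d` with the Euclidean norm and Lebesgue measure. -/
abbrev Space (d : ℕ) : Type := EuclideanSpace ℝ (Fin d)

/-- Probability densities with respect to Lebesgue measure. -/
structure IsDensity {d : ℕ} (ρ : Space d → ℝ) : Prop where
  measurable : Measurable ρ
  nonneg : ∀ x, 0 ≤ ρ x
  integrable : Integrable ρ
  integral_eq_one : ∫ x, ρ x = 1

/-- The conditional flow `φ_{t,x₁}(x₀) = (1 - t) x₀ + t x₁ + σ t x₀`; `σ = 0` is the linear one. -/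
def condFlow {d : ℕ} (σ t : ℝ) (x₁ x₀ : Space d) : Space d :=
  (1 - t) • x₀ + t • x₁ + (σ * t) • x₀

/-- The inverse `φ_{t,x₁}⁻¹(x)` of a conditional flow `φ`, at the times when it is invertible. -/
noncomputable def invFlow {d : ℕ} (φ : ℝ → Space d → Space d → Space d)
    (t : ℝ) (x₁ x : Space d) : Space d :=
  Function.invFun (φ t x₁) x

/-- The conditional velocity `w(t, x₁, x) = φ'_{t,x₁}(φ_{t,x₁}⁻¹(x))`. -/
noncomputable def condVelocity {d : ℕ} (φ : ℝ → Space d → Space d → Space d)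
    (t : ℝ) (x₁ x : Space d) : Space d :=
  deriv (fun s => φ s x₁ (invFlow φ t x₁ x)) t

/-- The conditional density `ρ_{x₁}(x, t)`: the push-forward of `ρ₀` under `φ_{t,x₁}`. -/
noncomputable def condDensity {d : ℕ} (φ : ℝ → Space d → Space d → Space d)
    (ρ₀ : Space d → ℝ) (t : ℝ) (x₁ x : Space d) : ℝ :=
  ρ₀ (invFlow φ t x₁ x) * |(fderiv ℝ (invFlow φ t x₁) x).det|

/-- The marginal density path `ρ_m(x, t) = ∫ ρ_{x₁}(x, t) ρ₁(x₁) dx₁`. -/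
noncomputable def margDensity {d : ℕ} (φ : ℝ → Space d → Space d → Space d)
    (ρ₀ ρ₁ : Space d → ℝ) (x : Space d) (t : ℝ) : ℝ :=
  ∫ x₁, condDensity φ ρ₀ t x₁ x * ρ₁ x₁

/-- The marginal vector field `∫ w(t, x₁, x) ρ_c(x | x₁, t) dx₁`, where
`ρ_c(x | x₁, t) = ρ_{x₁}(x, t) ρ₁(x₁) / ρ_m(x, t)`. -/
noncomputable def margField {d : ℕ} (φ : ℝ → Space d → Space d → Space d)
    (ρ₀ ρ₁ : Space d → ℝ) (x : Space d) (t : ℝ) : Space d :=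
  ∫ x₁, (condDensity φ ρ₀ t x₁ x * ρ₁ x₁ / margDensity φ ρ₀ ρ₁ x t) • condVelocity φ t x₁ x

/-- The explicit vector field
`∫ (x₁ - x) ρ₀((x - t x₁)/(1 - t)) ρ₁(x₁) dx₁ / ((1 - t) ∫ ρ₀((x - t x₁)/(1 - t)) ρ₁(x₁) dx₁)`. -/
noncomputable def explicitField {d : ℕ} (ρ₀ ρ₁ : Space d → ℝ) (x : Space d) (t : ℝ) : Space d :=
  ((1 - t) * ∫ x₁, ρ₀ ((1 - t)⁻¹ • (x - t • x₁)) * ρ₁ x₁)⁻¹ •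
    ∫ x₁, (ρ₀ ((1 - t)⁻¹ • (x - t • x₁)) * ρ₁ x₁) • (x₁ - x)

/-- The Flow Matching objective `E_t E_{x ∼ ρ(·,t)} ‖v̄(x, t) - v(x, t)‖ ^ p`, `t` uniform on
`[0, 1]`, as a function of `v`, with values in `[0, ∞]`. -/
noncomputable def flowMatchingObjective {d : ℕ} (p : ℝ) (ρ : Space d → ℝ → ℝ)
    (vbar v : Space d → ℝ → Space d) : ℝ≥0∞ :=
  ∫⁻ t in Icc (0 : ℝ) 1,
    ∫⁻ x, ‖vbar x t - v x t‖ₑ ^ p ∂(volume.withDensity fun x => ENNReal.ofReal (ρ x t))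

/-- The divergence of a vector field on `ℝ^d`: the trace of its derivative. -/
noncomputable def divergence {d : ℕ} (F : Space d → Space d) (x : Space d) : ℝ :=
  LinearMap.trace ℝ (Space d) (fderiv ℝ F x : Space d →ₗ[ℝ] Space d)

/-- `∂ρ/∂t = - div (ρ v)` on `ℝ^d × (0, 1)` with `ρ(·, 0) = ρ₀` and `ρ(·, 1) = ρ₁`, in the weak
sense: `ρ` and `ρ v` are integrable on `K × [0, 1]` for compact `K`, and the equation, boundary
conditions included, holds when tested against `C_c^∞(ℝ^d × ℝ)`. -/
structure IsWeakSolution {d : ℕ} (ρ : Space d → ℝ → ℝ) (v : Space d → ℝ → Space d)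
    (ρ₀ ρ₁ : Space d → ℝ) : Prop where
  integrableOn_density : ∀ K : Set (Space d), IsCompact K →
    IntegrableOn (fun q : Space d × ℝ => ρ q.1 q.2) (K ×ˢ Icc (0 : ℝ) 1)
  integrableOn_flux : ∀ K : Set (Space d), IsCompact K →
    IntegrableOn (fun q : Space d × ℝ => ρ q.1 q.2 • v q.1 q.2) (K ×ˢ Icc (0 : ℝ) 1)
  weak_eq : ∀ ψ : Space d × ℝ → ℝ, ContDiff ℝ ∞ ψ → HasCompactSupport ψ →
    ∫ t in (0 : ℝ)..1, ∫ x, (ρ x t * deriv (fun s => ψ (x, s)) t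
        + inner ℝ (ρ x t • v x t) (gradient (fun y => ψ (y, t)) x))
      = (∫ x, ψ (x, 1) * ρ₁ x) - ∫ x, ψ (x, 0) * ρ₀ x

/-- `∂ρ/∂t = - div (ρ v)` at every point of `ℝ^d × (0, 1)`, all derivatives existing. -/
def SolvesContinuityEquation {d : ℕ} (ρ : Space d → ℝ → ℝ) (v : Space d → ℝ → Space d) : Prop :=
  ∀ x : Space d, ∀ t ∈ Ioo (0 : ℝ) 1,
    DifferentiableAt ℝ (fun y => ρ y t • v y t) x ∧
    HasDerivAt (fun s => ρ x s) (-divergence (fun y => ρ y t • v y t) x) t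

end ExFM

/-! Put `a = 1 - t + σ t`. The conditional density is `a⁻ᵈ ρ₀((x - t x₁) / a)`, so the marginal
density is the law of `X_t = a Y + t X₁` with `Y ∼ ρ₀` and `X₁ ∼ ρ₁` independent. For `σ = 0` the
shear `(x₁, y) ↦ (x₁, (1 - t) y + t x₁)` turns integrals against density and flux into integrals
against `ρ₀(y) ρ₁(x₁)`, and the velocity `(x₁ - x) / (1 - t)` into `x₁ - y`. The weak equation is
then the mean over `(Y, X₁)` of the fundamental theorem of calculus for `t ↦ ψ(X_t, t)`
(`weak_eq_linear`). What needs care is integrability of the flux up to `t = 1`: a segment of speed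
`‖x₁ - y‖` stays in a ball of radius `R` for time at most `2R / ‖x₁ - y‖`, so speed times time is at
most `2R` (`integrable_path_speed`).

For the classical equation one differentiates under the integral in `t` and in `x`, and the trace of
the spatial derivative matches the time derivative. The limits at the final time are
approximate-identity statements for `a → 0`, `t → 1`. The explicit field is the marginal field after
cancelling `(1 - t)ᵈ`, so its objective vanishes. -/

namespace ExFM

/-! ### Closed forms for the linear flow, and the shear change of variables. -/

section

variable {d : ℕ}

/-- The density at `x` of `a y + t x₁`, where `y` has density `ρ₀`. -/
noncomputable def scaledDensity (ρ₀ : Space d → ℝ) (a t : ℝ) (x₁ x : Space d) : ℝ :=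
  (a ^ d)⁻¹ * ρ₀ (a⁻¹ • (x - t • x₁))

theorem condFlow_eq (σ t : ℝ) (x₁ x₀ : Space d) :
    condFlow σ t x₁ x₀ = (1 - t + σ * t) • x₀ + t • x₁ := by
  simp only [condFlow, add_smul]; abel

theorem invFlow_condFlow {σ t : ℝ} (h : 1 - t + σ * t ≠ 0) (x₁ x : Space d) :
    invFlow (condFlow σ) t x₁ x = (1 - t + σ * t)⁻¹ • (x - t • x₁) := by
  have hl : Function.LeftInverse (fun x : Space d => (1 - t + σ * t)⁻¹ • (x - t • x₁))
      (condFlow σ t x₁) := fun y => by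
    simp [condFlow_eq, smul_smul, inv_mul_cancel₀ h]
  -- `Function.invFun` promises only some preimage, so both sides are compared after applying the
  -- injective flow.
  apply hl.injective
  have hr : condFlow σ t x₁ ((1 - t + σ * t)⁻¹ • (x - t • x₁)) = x := by
    simp [condFlow_eq, smul_smul, mul_inv_cancel₀ h]
  rw [invFlow, Function.invFun_eq ⟨_, hr⟩, hr]

theorem condDensity_condFlow (ρ₀ : Space d → ℝ) {σ t : ℝ} (h : 0 < 1 - t + σ * t)
    (x₁ x : Space d) :
    condDensity (condFlow σ) ρ₀ t x₁ x = scaledDensity ρ₀ (1 - t + σ * t) t x₁ x := by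
  have hf : invFlow (condFlow σ) t x₁ =
      fun x : Space d => (1 - t + σ * t)⁻¹ • (x - t • x₁) :=
    funext (invFlow_condFlow h.ne' x₁)
  have hd : HasFDerivAt (fun x : Space d => (1 - t + σ * t)⁻¹ • (x - t • x₁))
      ((1 - t + σ * t)⁻¹ • ContinuousLinearMap.id ℝ (Space d)) x :=
    ((hasFDerivAt_id x).sub_const (t • x₁)).const_smul (1 - t + σ * t)⁻¹
  have hdet : ((1 - t + σ * t)⁻¹ • ContinuousLinearMap.id ℝ (Space d)).det =
      ((1 - t + σ * t) ^ d)⁻¹ := by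
    simp [ContinuousLinearMap.det]
  rw [condDensity, hf, hd.fderiv, hdet, abs_of_pos (by positivity), scaledDensity, mul_comm]

theorem condVelocity_condFlow_zero {t : ℝ} (h : t < 1) (x₁ x : Space d) :
    condVelocity (condFlow 0) t x₁ x = (1 - t)⁻¹ • (x₁ - x) := by
  have h0 : (1 - t) ≠ 0 := by linarith
  have hi := invFlow_condFlow (σ := 0) (t := t) (by simpa using h0) x₁ x
  rw [zero_mul, add_zero] at hi
  rw [condVelocity, hi]
  generalize hy : (1 - t)⁻¹ • (x - t • x₁) = y
  have hd : HasDerivAt (fun s : ℝ => condFlow 0 s x₁ y) (x₁ - y) t := by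
    have := (((hasDerivAt_id t).const_sub 1).smul_const y).add
      ((hasDerivAt_id t).smul_const x₁)
    simp only [condFlow, zero_mul, zero_smul, add_zero]
    refine this.congr_deriv ?_
    module
  rw [hd.deriv, ← hy]
  apply smul_right_injective _ h0
  simp only [smul_sub (1 - t), smul_inv_smul₀ h0]
  module

theorem margDensity_condFlow (ρ₀ ρ₁ : Space d → ℝ) {σ t : ℝ} (h : 0 < 1 - t + σ * t)
    (x : Space d) :
    margDensity (condFlow σ) ρ₀ ρ₁ x t =
      ∫ x₁, scaledDensity ρ₀ (1 - t + σ * t) t x₁ x * ρ₁ x₁ := by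
  simp only [margDensity, condDensity_condFlow ρ₀ h]

theorem margDensity_condFlow_zero (ρ₀ ρ₁ : Space d → ℝ) {t : ℝ} (h : t < 1) (x : Space d) :
    margDensity (condFlow 0) ρ₀ ρ₁ x t = ∫ x₁, scaledDensity ρ₀ (1 - t) t x₁ x * ρ₁ x₁ := by
  rw [margDensity_condFlow ρ₀ ρ₁ (by linarith)]; simp

theorem margField_condFlow_zero (ρ₀ ρ₁ : Space d → ℝ) {t : ℝ} (h : t < 1) (x : Space d) :
    margField (condFlow 0) ρ₀ ρ₁ x t = (margDensity (condFlow 0) ρ₀ ρ₁ x t)⁻¹ •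
      ∫ x₁, (scaledDensity ρ₀ (1 - t) t x₁ x * ρ₁ x₁) • (1 - t)⁻¹ • (x₁ - x) := by
  rw [margField, ← integral_smul]
  congr 1; ext1 x₁
  have hc := condDensity_condFlow ρ₀ (σ := 0) (t := t) (by linarith) x₁ x
  rw [zero_mul, add_zero] at hc
  rw [hc, condVelocity_condFlow_zero h, smul_smul (margDensity _ _ _ _ _)⁻¹, div_eq_inv_mul]

/-- Numerator and denominator both carry `(1 - t)⁻ᵈ`. Only this nonzero factor is cancelled, so
points with vanishing denominator are covered by the convention `0⁻¹ = 0`. -/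
theorem explicitField_eq_margField (ρ₀ ρ₁ : Space d → ℝ) {t : ℝ} (h : t < 1) (x : Space d) :
    explicitField ρ₀ ρ₁ x t = margField (condFlow 0) ρ₀ ρ₁ x t := by
  have h0 : 0 < 1 - t := by linarith
  have hd : ((1 - t) ^ d) ≠ 0 := by positivity
  rw [margField_condFlow_zero ρ₀ ρ₁ h, margDensity_condFlow_zero ρ₀ ρ₁ h, explicitField]
  have e1 : ∫ x₁, scaledDensity ρ₀ (1 - t) t x₁ x * ρ₁ x₁ =
      ((1 - t) ^ d)⁻¹ * ∫ x₁, ρ₀ ((1 - t)⁻¹ • (x - t • x₁)) * ρ₁ x₁ := by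
    rw [← integral_const_mul]; simp only [scaledDensity, mul_assoc]
  have e2 : ∫ x₁, (scaledDensity ρ₀ (1 - t) t x₁ x * ρ₁ x₁) • (1 - t)⁻¹ • (x₁ - x) =
      (((1 - t) ^ d)⁻¹ * (1 - t)⁻¹) •
        ∫ x₁, (ρ₀ ((1 - t)⁻¹ • (x - t • x₁)) * ρ₁ x₁) • (x₁ - x) := by
    rw [← integral_smul]
    congr 1; ext1 x₁
    simp only [scaledDensity, smul_smul]
    ring_nf
  rw [e1, e2, smul_smul]
  congr 1
  simp only [mul_inv, inv_inv]
  rw [mul_comm ((1 - t) ^ d), mul_assoc, ← mul_assoc ((1 - t) ^ d), mul_inv_cancel₀ hd, one_mul,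
    mul_comm]

/-- The map `(x₁, y) ↦ (x₁, a y + t x₁)`. -/
noncomputable def shear (a t : ℝ) (ha : a ≠ 0) : Space d × Space d ≃ₜ Space d × Space d where
  toFun p := (p.1, a • p.2 + t • p.1)
  invFun p := (p.1, a⁻¹ • (p.2 - t • p.1))
  left_inv p := by simp [smul_smul, inv_mul_cancel₀ ha]
  right_inv p := by simp [smul_smul, mul_inv_cancel₀ ha]
  continuous_toFun := by fun_prop
  continuous_invFun := by fun_prop

/-- On each fibre the map is a dilation by `a` followed by a translation. -/
theorem measurePreserving_shear {a : ℝ} (t : ℝ) (ha : 0 < a) :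
    MeasurePreserving (shear (d := d) a t ha.ne') volume
      (ENNReal.ofReal (a ^ d)⁻¹ • volume) := by
  have hs : (ENNReal.ofReal (a ^ d)⁻¹ • volume : Measure (Space d × Space d)) =
      (volume : Measure (Space d)).prod (ENNReal.ofReal (a ^ d)⁻¹ • volume) := by
    rw [Measure.prod_smul_right]; rfl
  rw [hs]
  refine MeasurePreserving.skew_product (f := id) (g := fun x₁ y : Space d => a • y + t • x₁)
    (MeasurePreserving.id _) (by fun_prop) (ae_of_all _ fun x₁ => ?_)
  have : (fun y : Space d => a • y + t • x₁) = (· + t • x₁) ∘ (a • ·) := rfl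
  rw [this, ← Measure.map_map (by fun_prop) (by fun_prop), Measure.map_addHaar_smul _ ha.ne',
    Measure.map_smul, map_add_right_eq_self, finrank_euclideanSpace_fin,
    abs_of_pos (by positivity)]

variable {E : Type*} [NormedAddCommGroup E] [NormedSpace ℝ E]

theorem scaledDensity_shear (ρ₀ : Space d → ℝ) {a t : ℝ} (ha : 0 < a) (p : Space d × Space d) :
    scaledDensity ρ₀ a t (shear a t ha.ne' p).1 (shear a t ha.ne' p).2 =
      (a ^ d)⁻¹ * ρ₀ p.2 := by
  simp [scaledDensity, shear, smul_smul, inv_mul_cancel₀ ha.ne']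

/-- The factor `a⁻ᵈ` of the density cancels the one in the image measure. Since `shear` is a
measurable embedding, `F` may be arbitrary. -/
theorem integral_scaledDensity (ρ₀ ρ₁ : Space d → ℝ) {a t : ℝ} (ha : 0 < a)
    (F : Space d × Space d → E) :
    ∫ p : Space d × Space d, (scaledDensity ρ₀ a t p.1 p.2 * ρ₁ p.1) • F p =
      ∫ p : Space d × Space d, (ρ₀ p.2 * ρ₁ p.1) • F (p.1, a • p.2 + t • p.1) := by
  have hc : 0 < (a ^ d)⁻¹ := by positivity
  have := (measurePreserving_shear t ha).integral_comp (shear a t ha.ne').measurableEmbedding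
    (fun p : Space d × Space d => (scaledDensity ρ₀ a t p.1 p.2 * ρ₁ p.1) • F p)
  rw [integral_smul_measure, ENNReal.toReal_ofReal hc.le] at this
  apply smul_right_injective E hc.ne'
  simp only
  rw [← this, ← integral_smul]
  congr 1; ext1 p
  rw [scaledDensity_shear ρ₀ ha, smul_smul, ← mul_assoc]
  rfl

theorem integrable_scaledDensity_iff (ρ₀ ρ₁ : Space d → ℝ) {a t : ℝ} (ha : 0 < a)
    (F : Space d × Space d → E) :
    Integrable (fun p : Space d × Space d => (scaledDensity ρ₀ a t p.1 p.2 * ρ₁ p.1) • F p) ↔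
      Integrable (fun p : Space d × Space d =>
        (ρ₀ p.2 * ρ₁ p.1) • F (p.1, a • p.2 + t • p.1)) := by
  have hc : 0 < (a ^ d)⁻¹ := by positivity
  have := (measurePreserving_shear t ha).integrable_comp_emb
    (shear a t ha.ne').measurableEmbedding
    (g := fun p : Space d × Space d => (scaledDensity ρ₀ a t p.1 p.2 * ρ₁ p.1) • F p)
  rw [integrable_smul_measure (by simpa using hc) ENNReal.ofReal_ne_top] at this
  rw [← this, ← integrable_smul_iff hc.ne' (fun p : Space d × Space d =>
        (ρ₀ p.2 * ρ₁ p.1) • F (p.1, a • p.2 + t • p.1))]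
  refine iff_of_eq (congrArg (fun f => Integrable f volume) ?_)
  ext1 p
  simp only [Function.comp_apply, Pi.smul_apply]
  rw [scaledDensity_shear ρ₀ ha, smul_smul, ← mul_assoc]
  rfl

end

/-! ### Marginal densities and the flux. -/

section

variable {d : ℕ} {ρ₀ ρ₁ : Space d → ℝ}
variable {E : Type*} [NormedAddCommGroup E] [NormedSpace ℝ E]

theorem scaledDensity_nonneg (h : ∀ x, 0 ≤ ρ₀ x) {a : ℝ} (ha : 0 ≤ a) (t : ℝ) (x₁ x : Space d) :
    0 ≤ scaledDensity ρ₀ a t x₁ x :=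
  mul_nonneg (by positivity) (h _)

theorem measurable_scaledDensity (h : Measurable ρ₀) {X : Type*} [MeasurableSpace X]
    {a t : X → ℝ} {x₁ x : X → Space d} (ha : Measurable a) (ht : Measurable t)
    (hx₁ : Measurable x₁) (hx : Measurable x) :
    Measurable fun q => scaledDensity ρ₀ (a q) (t q) (x₁ q) (x q) := by
  unfold scaledDensity
  exact (ha.pow_const d).inv.mul (h.comp (ha.inv.smul (hx.sub (ht.smul hx₁))))

theorem integrable_density_prod (h₀ : IsDensity ρ₀) (h₁ : IsDensity ρ₁) :
    Integrable (fun p : Space d × Space d => ρ₀ p.2 * ρ₁ p.1) :=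
  (h₁.integrable.mul_prod h₀.integrable).congr (ae_of_all _ fun _ => mul_comm _ _)

theorem integral_density_prod (h₀ : IsDensity ρ₀) (h₁ : IsDensity ρ₁) :
    ∫ p : Space d × Space d, ρ₀ p.2 * ρ₁ p.1 = 1 := by
  have := integral_prod_mul (μ := (volume : Measure (Space d))) (ν := (volume : Measure (Space d)))
    ρ₁ ρ₀
  rw [h₀.integral_eq_one, h₁.integral_eq_one, one_mul] at this
  exact (integral_congr_ae (ae_of_all _ fun _ => mul_comm _ _)).trans this

theorem integrable_scaledDensity_prod (h₀ : IsDensity ρ₀) (h₁ : IsDensity ρ₁) {a : ℝ}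
    (ha : 0 < a) (t : ℝ) :
    Integrable (fun p : Space d × Space d => scaledDensity ρ₀ a t p.1 p.2 * ρ₁ p.1) := by
  simpa using (integrable_scaledDensity_iff ρ₀ ρ₁ (t := t) ha (fun _ => (1 : ℝ))).2
    (by simpa using integrable_density_prod h₀ h₁)

theorem isDensity_margDensity (h₀ : IsDensity ρ₀) (h₁ : IsDensity ρ₁) {t : ℝ} (ht : t < 1) :
    IsDensity (fun x => margDensity (condFlow 0) ρ₀ ρ₁ x t) := by
  have ha : 0 < 1 - t := by linarith
  simp only [margDensity_condFlow_zero ρ₀ ρ₁ ht]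
  have hi := integrable_scaledDensity_prod h₀ h₁ ha t
  refine ⟨?_, fun x => ?_, hi.integral_prod_right, ?_⟩
  · have : Measurable fun p : Space d × Space d =>
        scaledDensity ρ₀ (1 - t) t p.2 p.1 * ρ₁ p.2 :=
      (measurable_scaledDensity h₀.measurable measurable_const measurable_const measurable_snd
        measurable_fst).mul (h₁.measurable.comp measurable_snd)
    exact this.stronglyMeasurable.integral_prod_right'.measurable
  · exact integral_nonneg fun x₁ =>
      mul_nonneg (scaledDensity_nonneg h₀.nonneg ha.le t x₁ x) (h₁.nonneg x₁)
  · rw [← integral_prod_symm _ hi]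
    have := integral_scaledDensity ρ₀ ρ₁ (t := t) ha (fun _ => (1 : ℝ))
    simp only [smul_eq_mul, mul_one] at this
    rw [integral_density_prod h₀ h₁] at this
    exact this

theorem margDensity_zero (h₁ : IsDensity ρ₁) (x : Space d) :
    margDensity (condFlow 0) ρ₀ ρ₁ x 0 = ρ₀ x := by
  rw [margDensity_condFlow_zero ρ₀ ρ₁ one_pos]
  simp [scaledDensity, integral_const_mul, h₁.integral_eq_one]

theorem integrable_scaledDensity_smul (h₀ : IsDensity ρ₀) (hb : ∃ C : ℝ, ∀ x, ρ₀ x ≤ C)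
    {g : Space d → E} (hg : Integrable g) {a : ℝ} (ha : 0 ≤ a) (t : ℝ) (x : Space d) :
    Integrable (fun x₁ => scaledDensity ρ₀ a t x₁ x • g x₁) := by
  obtain ⟨C, hC⟩ := hb
  refine hg.bdd_smul ((a ^ d)⁻¹ * C) ?_ (ae_of_all _ fun x₁ => ?_)
  · exact (measurable_scaledDensity h₀.measurable measurable_const measurable_const measurable_id
      measurable_const).aestronglyMeasurable
  · rw [Real.norm_of_nonneg (scaledDensity_nonneg h₀.nonneg ha t x₁ x)]
    exact mul_le_mul_of_nonneg_left (hC _) (by positivity)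

theorem integrable_smul_sub (h₁ : IsDensity ρ₁) (hm : Integrable (fun x => ‖x‖ * ρ₁ x))
    (x : Space d) : Integrable (fun x₁ => ρ₁ x₁ • (x₁ - x)) := by
  simp only [smul_sub]
  refine Integrable.sub ?_ (h₁.integrable.smul_const x)
  refine hm.mono (h₁.measurable.smul measurable_id).aestronglyMeasurable (ae_of_all _ fun y => ?_)
  simp [norm_smul, mul_comm]

/-- The flux `∫ ρ_{x₁}(x, t) ρ₁(x₁) w(t, x₁, x) dx₁` of the linear conditional flow. -/
noncomputable def linearFlux (ρ₀ ρ₁ : Space d → ℝ) (x : Space d) (t : ℝ) : Space d :=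
  ∫ x₁, (scaledDensity ρ₀ (1 - t) t x₁ x * ρ₁ x₁) • (1 - t)⁻¹ • (x₁ - x)

/-- The point is the zero set of the density: there a nonnegative integrable function has integral
zero, hence vanishes a.e., and the flux vanishes too. -/
theorem margDensity_smul_margField (h₀ : IsDensity ρ₀) (h₁ : IsDensity ρ₁)
    (hb : ∃ C : ℝ, ∀ x, ρ₀ x ≤ C) {t : ℝ} (ht : t < 1) (x : Space d) :
    margDensity (condFlow 0) ρ₀ ρ₁ x t • margField (condFlow 0) ρ₀ ρ₁ x t =
      linearFlux ρ₀ ρ₁ x t := by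
  have ha : 0 < 1 - t := by linarith
  rw [margField_condFlow_zero ρ₀ ρ₁ ht, linearFlux]
  by_cases h : margDensity (condFlow 0) ρ₀ ρ₁ x t = 0
  · rw [h, zero_smul]
    rw [margDensity_condFlow_zero ρ₀ ρ₁ ht, integral_eq_zero_iff_of_nonneg
      (fun x₁ => mul_nonneg (scaledDensity_nonneg h₀.nonneg ha.le t x₁ x) (h₁.nonneg x₁))
      (integrable_scaledDensity_smul h₀ hb h₁.integrable ha.le t x)] at h
    symm
    apply integral_eq_zero_of_ae
    filter_upwards [h] with x₁ hx₁
    simp only [Pi.zero_apply] at hx₁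
    simp [hx₁]
  · rw [smul_inv_smul₀ h]

end

/-! ### Integrability in space-time by passing to paths. -/

section

variable {d : ℕ} {ρ₀ ρ₁ : Space d → ℝ}
variable {E : Type*} [NormedAddCommGroup E] [NormedSpace ℝ E]

/-- The shear at each fixed `t < 1` preserves integrability and the integral of the norm, so
Fubini's criterion transfers from path coordinates to space coordinates. -/
theorem integrable_time_scaledDensity (h₀ : IsDensity ρ₀) (h₁ : IsDensity ρ₁)
    {F : ℝ × (Space d × Space d) → E} (hF : StronglyMeasurable F)
    (hint : Integrable (fun q : ℝ × (Space d × Space d) =>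
      (ρ₀ q.2.2 * ρ₁ q.2.1) • F (q.1, q.2.1, (1 - q.1) • q.2.2 + q.1 • q.2.1))
      ((volume.restrict (Ico (0 : ℝ) 1)).prod volume)) :
    Integrable (fun q : ℝ × (Space d × Space d) =>
      (scaledDensity ρ₀ (1 - q.1) q.1 q.2.1 q.2.2 * ρ₁ q.2.1) • F q)
      ((volume.restrict (Ico (0 : ℝ) 1)).prod volume) := by
  have hmeas : Measurable fun q : ℝ × (Space d × Space d) =>
      scaledDensity ρ₀ (1 - q.1) q.1 q.2.1 q.2.2 * ρ₁ q.2.1 :=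
    (measurable_scaledDensity h₀.measurable (by fun_prop) (by fun_prop) (by fun_prop)
      (by fun_prop)).mul (h₁.measurable.comp (by fun_prop))
  have hS : AEStronglyMeasurable (fun q : ℝ × (Space d × Space d) =>
      (scaledDensity ρ₀ (1 - q.1) q.1 q.2.1 q.2.2 * ρ₁ q.2.1) • F q)
      ((volume.restrict (Ico (0 : ℝ) 1)).prod volume) :=
    (hmeas.stronglyMeasurable.smul hF).aestronglyMeasurable
  have hI := (integrable_prod_iff hint.1).1 hint
  refine (integrable_prod_iff hS).2 ⟨?_, hI.2.congr ?_⟩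
  · filter_upwards [hI.1, ae_restrict_mem measurableSet_Ico] with t hi ht
    exact (integrable_scaledDensity_iff ρ₀ ρ₁ (sub_pos.2 ht.2) (fun p => F (t, p))).2 hi
  · filter_upwards [ae_restrict_mem measurableSet_Ico] with t ht
    have ha : 0 < 1 - t := sub_pos.2 ht.2
    have := integral_scaledDensity ρ₀ ρ₁ (t := t) ha (fun p => ‖F (t, p)‖)
    have e : ∀ (c : ℝ) (v : E), 0 ≤ c → ‖c • v‖ = c • ‖v‖ := fun c v hc => by
      rw [norm_smul, Real.norm_of_nonneg hc, smul_eq_mul]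
    simp only [e _ _ (mul_nonneg (h₀.nonneg _) (h₁.nonneg _)),
      e _ _ (mul_nonneg (scaledDensity_nonneg h₀.nonneg ha.le _ _ _) (h₁.nonneg _))]
    exact this.symm

/-- The indicator function of the closed ball of radius `R` about the origin. -/
noncomputable def ballIndicator (R : ℝ) : Space d → ℝ :=
  (Metric.closedBall (0 : Space d) R).indicator 1

theorem ballIndicator_nonneg (R : ℝ) (x : Space d) : 0 ≤ ballIndicator R x :=
  indicator_nonneg (fun _ _ => zero_le_one) x

theorem ballIndicator_le_one (R : ℝ) (x : Space d) : ballIndicator R x ≤ 1 :=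
  indicator_le' (fun _ _ => le_rfl) (fun _ _ => zero_le_one) x

theorem measurable_ballIndicator (R : ℝ) : Measurable (ballIndicator (d := d) R) :=
  measurable_one.indicator Metric.isClosed_closedBall.measurableSet

/-- The part of a segment that lies in a ball is not longer than the diameter. -/
theorem integral_ballIndicator_segment_le {R : ℝ} (hR : 0 ≤ R) (x₁ y : Space d) :
    ∫ t in Ico (0 : ℝ) 1, ballIndicator R ((1 - t) • y + t • x₁) * ‖x₁ - y‖ ≤ 2 * R := by
  rcases eq_or_ne x₁ y with rfl | hne
  · simpa using hR
  have hn : 0 < ‖x₁ - y‖ := norm_pos_iff.2 (sub_ne_zero.2 hne)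
  set B : Set ℝ := {t | (1 - t) • y + t • x₁ ∈ Metric.closedBall (0 : Space d) R} with hB
  have hBm : MeasurableSet B :=
    (Metric.isClosed_closedBall.preimage
      (show Continuous fun t : ℝ => (1 - t) • y + t • x₁ by fun_prop)).measurableSet
  -- Times `s`, `t` in `B` give points of the ball at distance `|s - t| ‖x₁ - y‖`; a set of reals
  -- has measure at most its diameter.
  have hd : ∀ s ∈ B, ∀ t ∈ B, dist s t ≤ 2 * R / ‖x₁ - y‖ := by
    intro s hs t ht
    rw [le_div_iff₀ hn, Real.dist_eq, ← Real.norm_eq_abs, ← norm_smul]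
    have : (s - t) • (x₁ - y) = ((1 - s) • y + s • x₁) - ((1 - t) • y + t • x₁) := by module
    rw [this]
    have h1 := mem_closedBall_zero_iff.1 hs
    have h2 := mem_closedBall_zero_iff.1 ht
    linarith [norm_sub_le ((1 - s) • y + s • x₁) ((1 - t) • y + t • x₁)]
  have hv : volume B ≤ ENNReal.ofReal (2 * R / ‖x₁ - y‖) :=
    (Real.volume_le_diam B).trans (Metric.ediam_le_of_forall_dist_le hd)
  have hr : volume.real (B ∩ Ico 0 1) ≤ 2 * R / ‖x₁ - y‖ :=
    ENNReal.toReal_le_of_le_ofReal (by positivity) ((measure_mono inter_subset_left).trans hv)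
  have e : (fun t : ℝ => ballIndicator R ((1 - t) • y + t • x₁)) = B.indicator 1 := by
    ext t; simp [ballIndicator, indicator, hB]
  rw [integral_mul_const, e, integral_indicator_one hBm, measureReal_restrict_apply hBm]
  rwa [le_div_iff₀ hn] at hr

/-- Integrating in time first leaves at most `2R ρ₀ ρ₁`, so no moment of `ρ₀` enters. -/
theorem integrable_path_speed (h₀ : IsDensity ρ₀) (h₁ : IsDensity ρ₁) {R : ℝ} (hR : 0 ≤ R) :
    Integrable (fun q : ℝ × (Space d × Space d) => (ρ₀ q.2.2 * ρ₁ q.2.1) *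
      (ballIndicator R ((1 - q.1) • q.2.2 + q.1 • q.2.1) * ‖q.2.1 - q.2.2‖))
      ((volume.restrict (Ico (0 : ℝ) 1)).prod volume) := by
  have hm : Measurable fun q : ℝ × (Space d × Space d) =>
      ballIndicator R ((1 - q.1) • q.2.2 + q.1 • q.2.1) * ‖q.2.1 - q.2.2‖ :=
    ((measurable_ballIndicator R).comp (by fun_prop)).mul (by fun_prop)
  have hm' : Measurable fun q : ℝ × (Space d × Space d) => ρ₀ q.2.2 * ρ₁ q.2.1 :=
    (h₀.measurable.comp (by fun_prop)).mul (h₁.measurable.comp (by fun_prop))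
  have hn : ∀ q : ℝ × (Space d × Space d),
      0 ≤ ballIndicator R ((1 - q.1) • q.2.2 + q.1 • q.2.1) * ‖q.2.1 - q.2.2‖ := fun q =>
    mul_nonneg (ballIndicator_nonneg _ _) (norm_nonneg _)
  have hn' : ∀ p : Space d × Space d, 0 ≤ ρ₀ p.2 * ρ₁ p.1 := fun p =>
    mul_nonneg (h₀.nonneg _) (h₁.nonneg _)
  have hmm : Measurable fun q : ℝ × (Space d × Space d) => (ρ₀ q.2.2 * ρ₁ q.2.1) *
      (ballIndicator R ((1 - q.1) • q.2.2 + q.1 • q.2.1) * ‖q.2.1 - q.2.2‖) := hm'.mul hm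
  refine (integrable_prod_iff' hmm.aestronglyMeasurable).2
    ⟨ae_of_all _ fun p => ?_, ?_⟩
  · have hmp : AEStronglyMeasurable (fun t : ℝ =>
        ballIndicator R ((1 - t) • p.2 + t • p.1) * ‖p.1 - p.2‖) (volume.restrict (Ico 0 1)) :=
      (hm.comp measurable_prodMk_right).aestronglyMeasurable
    refine Integrable.const_mul (Integrable.of_bound hmp ‖p.1 - p.2‖
      (ae_of_all _ fun t => ?_)) (ρ₀ p.2 * ρ₁ p.1)
    rw [Real.norm_of_nonneg (hn (t, p))]
    exact mul_le_of_le_one_left (norm_nonneg _) (ballIndicator_le_one _ _)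
  · refine ((integrable_density_prod h₀ h₁).mul_const (2 * R)).mono' ?_ (ae_of_all _ fun p => ?_)
    · exact hmm.norm.stronglyMeasurable.integral_prod_left'.aestronglyMeasurable
    · rw [Real.norm_of_nonneg (integral_nonneg fun _ => norm_nonneg _)]
      have e : ∀ t : ℝ, ‖(ρ₀ p.2 * ρ₁ p.1) *
          (ballIndicator R ((1 - t) • p.2 + t • p.1) * ‖p.1 - p.2‖)‖ = (ρ₀ p.2 * ρ₁ p.1) *
          (ballIndicator R ((1 - t) • p.2 + t • p.1) * ‖p.1 - p.2‖) := fun t =>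
        Real.norm_of_nonneg (mul_nonneg (hn' p) (hn (t, p)))
      refine (integral_congr_ae (ae_of_all _ e)).trans_le ?_
      rw [integral_const_mul]
      exact mul_le_mul_of_nonneg_left (integral_ballIndicator_segment_le hR _ _) (hn' p)

/-- Integrability against time and both endpoints gives integrability in time and space of the
integral over the end point. -/
theorem integrable_integral_endpoint [CompleteSpace E] {G : ℝ × (Space d × Space d) → E}
    {m : Measure ℝ} [SFinite m] (hG : Integrable G (m.prod volume)) :
    Integrable (fun q : Space d × ℝ => ∫ x₁, G (q.2, x₁, q.1)) (volume.prod m) := by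
  have h1 : MeasurePreserving
      (fun r : (Space d × ℝ) × Space d => (r.1.2, r.2, r.1.1))
      (((volume : Measure (Space d)).prod m).prod (volume : Measure (Space d)))
      (m.prod ((volume : Measure (Space d)).prod (volume : Measure (Space d)))) := by
    have a1 := measurePreserving_prodAssoc (volume : Measure (Space d)) m
      (volume : Measure (Space d))
    have a2 := Measure.measurePreserving_swap (μ := (volume : Measure (Space d)))
      (ν := m.prod (volume : Measure (Space d)))
    have a3 := measurePreserving_prodAssoc m (volume : Measure (Space d))
      (volume : Measure (Space d))
    exact a3.comp (a2.comp a1)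
  exact (h1.integrable_comp_of_integrable hG).integral_prod_left

end

/-! ### The weak continuity equation. -/

section

variable {d : ℕ} {ρ₀ ρ₁ : Space d → ℝ}

theorem integrableOn_prod_Icc {E : Type*} [NormedAddCommGroup E] {g : Space d × ℝ → E}
    (hg : Integrable g ((volume : Measure (Space d)).prod (volume.restrict (Ico (0 : ℝ) 1))))
    (K : Set (Space d)) : IntegrableOn g (K ×ˢ Icc (0 : ℝ) 1) := by
  rw [IntegrableOn, Measure.volume_eq_prod, ← Measure.prod_restrict,
    Measure.restrict_congr_set (Ico_ae_eq_Icc (μ := volume) (a := (0 : ℝ)) (b := 1)).symm]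
  exact hg.mono_measure (Measure.prod_mono Measure.restrict_le_self le_rfl)

theorem ae_snd_mem_Ico : ∀ᵐ q ∂((volume : Measure (Space d)).prod
    (volume.restrict (Ico (0 : ℝ) 1))), q.2 ∈ Ico (0 : ℝ) 1 :=
  Measure.quasiMeasurePreserving_snd.ae (ae_restrict_mem measurableSet_Ico)

theorem ae_fst_mem_Ico : ∀ᵐ q ∂((volume.restrict (Ico (0 : ℝ) 1)).prod
    (volume : Measure (Space d × Space d))), q.1 ∈ Ico (0 : ℝ) 1 :=
  Measure.quasiMeasurePreserving_fst.ae (ae_restrict_mem measurableSet_Ico)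

theorem integrable_time_density_prod (h₀ : IsDensity ρ₀) (h₁ : IsDensity ρ₁) :
    Integrable (fun q : ℝ × (Space d × Space d) => ρ₀ q.2.2 * ρ₁ q.2.1)
      ((volume.restrict (Ico (0 : ℝ) 1)).prod volume) :=
  (integrable_density_prod h₀ h₁).comp_snd _

theorem integrable_margDensity (h₀ : IsDensity ρ₀) (h₁ : IsDensity ρ₁) :
    Integrable (fun q : Space d × ℝ => margDensity (condFlow 0) ρ₀ ρ₁ q.1 q.2)
      ((volume : Measure (Space d)).prod (volume.restrict (Ico (0 : ℝ) 1))) := by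
  have := integrable_integral_endpoint (integrable_time_scaledDensity h₀ h₁
    (F := fun _ => (1 : ℝ)) stronglyMeasurable_const
    (by simpa using integrable_time_density_prod h₀ h₁))
  refine this.congr ?_
  filter_upwards [ae_snd_mem_Ico] with q hq
  rw [margDensity_condFlow_zero ρ₀ ρ₁ hq.2]
  simp

/-- This removes the singularity of the velocity at `t = 1`. -/
theorem velocity_along_path {t : ℝ} (ht : t < 1) (x₁ y : Space d) :
    (1 - t)⁻¹ • (x₁ - ((1 - t) • y + t • x₁)) = x₁ - y := by
  have : x₁ - ((1 - t) • y + t • x₁) = (1 - t) • (x₁ - y) := by module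
  rw [this, inv_smul_smul₀ (by linarith)]

theorem integrable_ballIndicator_linearFlux (h₀ : IsDensity ρ₀) (h₁ : IsDensity ρ₁) {R : ℝ}
    (hR : 0 ≤ R) :
    Integrable (fun q : Space d × ℝ => ballIndicator R q.1 • linearFlux ρ₀ ρ₁ q.1 q.2)
      ((volume : Measure (Space d)).prod (volume.restrict (Ico (0 : ℝ) 1))) := by
  have hF : Measurable fun q : ℝ × (Space d × Space d) =>
      ballIndicator R q.2.2 • (1 - q.1)⁻¹ • (q.2.1 - q.2.2) :=
    ((measurable_ballIndicator R).comp (by fun_prop)).smul (by fun_prop)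
  have hF' : Measurable fun q : ℝ × (Space d × Space d) => (ρ₀ q.2.2 * ρ₁ q.2.1) •
      ballIndicator R ((1 - q.1) • q.2.2 + q.1 • q.2.1) •
        (1 - q.1)⁻¹ • (q.2.1 - ((1 - q.1) • q.2.2 + q.1 • q.2.1)) :=
    ((h₀.measurable.comp (by fun_prop)).mul (h₁.measurable.comp (by fun_prop))).smul
      (((measurable_ballIndicator R).comp (by fun_prop)).smul (by fun_prop))
  have := integrable_integral_endpoint (integrable_time_scaledDensity h₀ h₁
    hF.stronglyMeasurable ?_)
  · refine this.congr (ae_of_all _ fun q => ?_)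
    simp only [linearFlux]
    rw [← integral_smul]
    congr 1; ext1 x₁
    rw [smul_comm]
  · refine (integrable_path_speed h₀ h₁ hR).mono hF'.aestronglyMeasurable ?_
    filter_upwards [ae_fst_mem_Ico] with q hq
    rw [velocity_along_path hq.2]
    simp [norm_smul]

/-- The space-time derivative of a function along the vector field `(w, 1)`. -/
theorem deriv_add_inner_gradient {ψ : Space d × ℝ → ℝ} (hψ : Differentiable ℝ ψ)
    (x w : Space d) (t : ℝ) :
    deriv (fun s => ψ (x, s)) t + inner ℝ w (gradient (fun y => ψ (y, t)) x) =
      fderiv ℝ ψ (x, t) (w, 1) := by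
  have h1 : HasDerivAt (fun s => ψ (x, s)) (fderiv ℝ ψ (x, t) (0, 1)) t :=
    (hψ (x, t)).hasFDerivAt.comp_hasDerivAt t ((hasDerivAt_const t x).prodMk (hasDerivAt_id t))
  have h2 : HasFDerivAt (fun y => ψ (y, t))
      ((fderiv ℝ ψ (x, t)).comp (ContinuousLinearMap.inl ℝ (Space d) ℝ)) x :=
    (hψ (x, t)).hasFDerivAt.comp x (hasFDerivAt_prodMk_left x t)
  rw [h1.deriv, gradient, h2.fderiv, real_inner_comm, InnerProductSpace.toDual_symm_apply,
    ContinuousLinearMap.comp_apply, ContinuousLinearMap.inl_apply, ← map_add]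
  simp

theorem integral_fderiv_along_path {ψ : Space d × ℝ → ℝ} (hψ : ContDiff ℝ 1 ψ)
    (x₁ y : Space d) :
    ∫ t in (0 : ℝ)..1, fderiv ℝ ψ ((1 - t) • y + t • x₁, t) (x₁ - y, 1) =
      ψ (x₁, 1) - ψ (y, 0) := by
  have hd : ∀ t : ℝ, HasDerivAt (fun t : ℝ => ψ ((1 - t) • y + t • x₁, t))
      (fderiv ℝ ψ ((1 - t) • y + t • x₁, t) (x₁ - y, 1)) t := fun t => by
    have hp : HasDerivAt (fun t : ℝ => (1 - t) • y + t • x₁) (x₁ - y) t := by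
      have := (((hasDerivAt_id t).const_sub 1).smul_const y).add
        ((hasDerivAt_id t).smul_const x₁)
      exact this.congr_deriv (by module)
    exact ((hψ.differentiable one_ne_zero) _).hasFDerivAt.comp_hasDerivAt t
      (hp.prodMk (hasDerivAt_id t))
  have hc : Continuous fun t : ℝ =>
      fderiv ℝ ψ ((1 - t) • y + t • x₁, t) (x₁ - y, 1) :=
    ((hψ.continuous_fderiv one_ne_zero).comp (by fun_prop)).clm_apply continuous_const
  rw [intervalIntegral.integral_eq_sub_of_hasDerivAt (fun t _ => hd t)
    (hc.intervalIntegrable _ _)]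
  simp

/-- The bound has this form because `‖w‖` becomes integrable along paths only after cutting off to a
ball. -/
theorem exists_fderiv_bound {ψ : Space d × ℝ → ℝ} (hψ : ContDiff ℝ 1 ψ)
    (hc : HasCompactSupport ψ) :
    ∃ M R : ℝ, 0 ≤ M ∧ 0 ≤ R ∧
      ∀ (x w : Space d) (t : ℝ), |fderiv ℝ ψ (x, t) (w, 1)| ≤
        M * (ballIndicator R x * ‖w‖ + 1) := by
  obtain ⟨M, hM⟩ := (hψ.continuous_fderiv one_ne_zero).bounded_above_of_compact_support
    (hc.fderiv (𝕜 := ℝ))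
  obtain ⟨R, hR⟩ := (hc.fderiv (𝕜 := ℝ)).isBounded.subset_closedBall 0
  -- `R` may be negative when the support is empty, hence `max R 0` below.
  have hM0 : 0 ≤ M := (norm_nonneg _).trans (hM 0)
  refine ⟨M, max R 0, hM0, le_max_right _ _, fun x w t => ?_⟩
  by_cases hx : x ∈ Metric.closedBall (0 : Space d) (max R 0)
  · have hw : ‖((w, 1) : Space d × ℝ)‖ ≤ ‖w‖ + 1 := by
      rw [Prod.norm_mk, norm_one]
      exact max_le (by linarith) (by linarith [norm_nonneg w])
    simp only [ballIndicator, indicator_of_mem hx, Pi.one_apply, one_mul]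
    exact ((fderiv ℝ ψ (x, t)).le_opNorm _).trans
      (mul_le_mul (hM _) hw (norm_nonneg _) hM0)
  · have hz : fderiv ℝ ψ (x, t) = 0 := by
      by_contra hne
      have := hR (subset_tsupport _ (Function.mem_support.2 hne))
      rw [mem_closedBall_zero_iff, Prod.norm_mk] at this
      rw [mem_closedBall_zero_iff] at hx
      exact hx ((le_max_left _ _).trans (this.trans (le_max_left _ _)))
    rw [hz]
    simp only [zero_apply, abs_zero]
    exact mul_nonneg hM0 (add_nonneg (mul_nonneg (ballIndicator_nonneg _ _) (norm_nonneg _))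
      zero_le_one)

/-- The first moment of `ρ₁` makes the flux integrand integrable at fixed `x`, so the inner product
moves inside the integral. -/
theorem margDensity_mul_add_inner (h₀ : IsDensity ρ₀) (h₁ : IsDensity ρ₁)
    (hb : ∃ C : ℝ, ∀ x, ρ₀ x ≤ C) (hm : Integrable (fun x => ‖x‖ * ρ₁ x))
    {ψ : Space d × ℝ → ℝ} (hψ : Differentiable ℝ ψ) {t : ℝ} (ht : t < 1) (x : Space d) :
    margDensity (condFlow 0) ρ₀ ρ₁ x t * deriv (fun s => ψ (x, s)) t +
      inner ℝ (margDensity (condFlow 0) ρ₀ ρ₁ x t • margField (condFlow 0) ρ₀ ρ₁ x t)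
        (gradient (fun y => ψ (y, t)) x) =
    ∫ x₁, (scaledDensity ρ₀ (1 - t) t x₁ x * ρ₁ x₁) •
      fderiv ℝ ψ (x, t) ((1 - t)⁻¹ • (x₁ - x), 1) := by
  have ha : 0 < 1 - t := sub_pos.2 ht
  rw [margDensity_smul_margField h₀ h₁ hb ht, margDensity_condFlow_zero ρ₀ ρ₁ ht, linearFlux]
  have i1 : Integrable fun x₁ => scaledDensity ρ₀ (1 - t) t x₁ x * ρ₁ x₁ :=
    integrable_scaledDensity_smul h₀ hb h₁.integrable ha.le t x
  have i2 : Integrable fun x₁ =>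
      (scaledDensity ρ₀ (1 - t) t x₁ x * ρ₁ x₁) • (1 - t)⁻¹ • (x₁ - x) := by
    refine ((integrable_scaledDensity_smul h₀ hb (integrable_smul_sub h₁ hm x) ha.le t x).smul
      (1 - t)⁻¹).congr (ae_of_all _ fun x₁ => ?_)
    simp only [Pi.smul_apply, smul_smul]
    ring_nf
  rw [← integral_mul_const, real_inner_comm, ← integral_inner i2, ← integral_add]
  · congr 1; ext1 x₁
    rw [← deriv_add_inner_gradient hψ, inner_smul_right, smul_eq_mul, mul_add,
      real_inner_comm (gradient _ _)]
  · exact i1.mul_const _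
  · exact i2.const_inner _

theorem weak_eq_linear (h₀ : IsDensity ρ₀) (h₁ : IsDensity ρ₁)
    (hb : ∃ C : ℝ, ∀ x, ρ₀ x ≤ C) (hm : Integrable (fun x => ‖x‖ * ρ₁ x))
    {ψ : Space d × ℝ → ℝ} (hψ : ContDiff ℝ 1 ψ) (hc : HasCompactSupport ψ) :
    ∫ t in (0 : ℝ)..1, ∫ x, (margDensity (condFlow 0) ρ₀ ρ₁ x t * deriv (fun s => ψ (x, s)) t +
      inner ℝ (margDensity (condFlow 0) ρ₀ ρ₁ x t • margField (condFlow 0) ρ₀ ρ₁ x t)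
        (gradient (fun y => ψ (y, t)) x)) =
    (∫ x, ψ (x, 1) * ρ₁ x) - ∫ x, ψ (x, 0) * ρ₀ x := by
  have hψd := hψ.differentiable one_ne_zero
  have hfc := hψ.continuous_fderiv one_ne_zero
  obtain ⟨M, R, hM, hR, hbd⟩ := exists_fderiv_bound hψ hc
  have hF : Measurable fun q : ℝ × (Space d × Space d) =>
      fderiv ℝ ψ (q.2.2, q.1) ((1 - q.1)⁻¹ • (q.2.1 - q.2.2), 1) := by
    have : Continuous fun r : (Space d × ℝ) × (Space d × ℝ) => fderiv ℝ ψ r.1 r.2 :=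
      (hfc.comp continuous_fst).clm_apply continuous_snd
    exact this.measurable.comp (g := fun r : (Space d × ℝ) × (Space d × ℝ) => fderiv ℝ ψ r.1 r.2)
      (f := fun q : ℝ × (Space d × Space d) =>
        ((q.2.2, q.1), ((1 - q.1)⁻¹ • (q.2.1 - q.2.2), (1 : ℝ)))) (by fun_prop)
  have hpath : Integrable (fun q : ℝ × (Space d × Space d) => (ρ₀ q.2.2 * ρ₁ q.2.1) •
      fderiv ℝ ψ ((1 - q.1) • q.2.2 + q.1 • q.2.1, q.1) (q.2.1 - q.2.2, 1))
      ((volume.restrict (Ico (0 : ℝ) 1)).prod volume) := by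
    have hc' : Continuous fun q : ℝ × (Space d × Space d) =>
        fderiv ℝ ψ ((1 - q.1) • q.2.2 + q.1 • q.2.1, q.1) (q.2.1 - q.2.2, 1) :=
      (hfc.comp (by fun_prop)).clm_apply (by fun_prop)
    have hmeas : Measurable fun q : ℝ × (Space d × Space d) => (ρ₀ q.2.2 * ρ₁ q.2.1) •
        fderiv ℝ ψ ((1 - q.1) • q.2.2 + q.1 • q.2.1, q.1) (q.2.1 - q.2.2, 1) :=
      ((h₀.measurable.comp (by fun_prop)).mul (h₁.measurable.comp (by fun_prop))).smul
        hc'.measurable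
    refine (((integrable_path_speed h₀ h₁ hR).add
      (integrable_time_density_prod h₀ h₁)).const_mul M).mono' hmeas.aestronglyMeasurable
      (ae_of_all _ fun q => ?_)
    have hn : 0 ≤ ρ₀ q.2.2 * ρ₁ q.2.1 := mul_nonneg (h₀.nonneg _) (h₁.nonneg _)
    rw [norm_smul, Real.norm_of_nonneg hn, Real.norm_eq_abs]
    refine (mul_le_mul_of_nonneg_left (hbd _ _ _) hn).trans_eq ?_
    simp only [Pi.add_apply]
    ring
  have hspace := integrable_time_scaledDensity h₀ h₁ hF.stronglyMeasurable (hpath.congr (by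
    filter_upwards [ae_fst_mem_Ico] with q hq
    rw [velocity_along_path hq.2]))
  calc _ = ∫ t in Ico (0 : ℝ) 1, ∫ x,
        (margDensity (condFlow 0) ρ₀ ρ₁ x t * deriv (fun s => ψ (x, s)) t +
      inner ℝ (margDensity (condFlow 0) ρ₀ ρ₁ x t • margField (condFlow 0) ρ₀ ρ₁ x t)
        (gradient (fun y => ψ (y, t)) x)) := by
        rw [intervalIntegral.integral_of_le zero_le_one, integral_Ico_eq_integral_Ioc]
    -- For almost every `t`: Fubini in `(x₁, x)`, then the shear.
    _ = ∫ t in Ico (0 : ℝ) 1, ∫ p : Space d × Space d, (ρ₀ p.2 * ρ₁ p.1) •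
        fderiv ℝ ψ ((1 - t) • p.2 + t • p.1, t) (p.1 - p.2, 1) := by
      apply integral_congr_ae
      filter_upwards [hspace.prod_right_ae, ae_restrict_mem measurableSet_Ico] with t hi ht
      simp only [margDensity_mul_add_inner h₀ h₁ hb hm hψd ht.2]
      have h1 := integral_prod_symm _ hi
      have h2 := integral_scaledDensity ρ₀ ρ₁ (t := t) (sub_pos.2 ht.2) fun p =>
        fderiv ℝ ψ (p.2, t) ((1 - t)⁻¹ • (p.1 - p.2), 1)
      simp only [velocity_along_path ht.2] at h2
      exact h1.symm.trans h2
    _ = ∫ p : Space d × Space d, ∫ t in Ico (0 : ℝ) 1, (ρ₀ p.2 * ρ₁ p.1) •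
        fderiv ℝ ψ ((1 - t) • p.2 + t • p.1, t) (p.1 - p.2, 1) :=
      integral_integral_swap hpath
    _ = ∫ p : Space d × Space d, (ρ₀ p.2 * (ψ (p.1, 1) * ρ₁ p.1) -
          (ψ (p.2, 0) * ρ₀ p.2) * ρ₁ p.1) := by
      congr 1; ext1 p
      rw [integral_smul, integral_Ico_eq_integral_Ioc,
        ← intervalIntegral.integral_of_le zero_le_one, integral_fderiv_along_path hψ, smul_eq_mul]
      ring
    _ = _ := by
      have hψc := hψ.continuous
      obtain ⟨C, hC⟩ := hψc.bounded_above_of_compact_support hc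
      have i1 : Integrable fun x => ψ (x, 1) * ρ₁ x :=
        h₁.integrable.bdd_mul (c := C)
          (show Continuous fun x => ψ (x, 1) by fun_prop).aestronglyMeasurable
          (ae_of_all _ fun x => hC _)
      have i0 : Integrable fun x => ψ (x, 0) * ρ₀ x :=
        h₀.integrable.bdd_mul (c := C)
          (show Continuous fun x => ψ (x, 0) by fun_prop).aestronglyMeasurable
          (ae_of_all _ fun x => hC _)
      have j1 := (i1.mul_prod h₀.integrable).congr (ae_of_all _ fun p => mul_comm _ _)
      have j0 := (h₁.integrable.mul_prod i0).congr (ae_of_all _ fun p => mul_comm _ _)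
      have k1 := integral_prod_mul (μ := (volume : Measure (Space d)))
        (ν := (volume : Measure (Space d))) (fun x => ψ (x, 1) * ρ₁ x) ρ₀
      have k0 := integral_prod_mul (μ := (volume : Measure (Space d)))
        (ν := (volume : Measure (Space d))) ρ₁ (fun x => ψ (x, 0) * ρ₀ x)
      rw [h₀.integral_eq_one, mul_one] at k1
      rw [h₁.integral_eq_one, one_mul] at k0
      rw [← k1, ← k0]
      refine (integral_sub j1 j0).trans ?_
      simp only [mul_comm]

theorem isWeakSolution_linear (h₀ : IsDensity ρ₀) (h₁ : IsDensity ρ₁)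
    (hb : ∃ C : ℝ, ∀ x, ρ₀ x ≤ C) (hm : Integrable (fun x => ‖x‖ * ρ₁ x)) :
    IsWeakSolution (margDensity (condFlow 0) ρ₀ ρ₁) (margField (condFlow 0) ρ₀ ρ₁) ρ₀ ρ₁ where
  integrableOn_density K _ := integrableOn_prod_Icc (integrable_margDensity h₀ h₁) K
  integrableOn_flux K hK := by
    obtain ⟨R, hR⟩ := hK.isBounded.subset_closedBall 0
    have hi := integrableOn_prod_Icc
      (integrable_ballIndicator_linearFlux h₀ h₁ (le_max_right R 0)) K
    -- At `t = 1` the flow is not invertible and the flux formula is unavailable, but this slice is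
    -- null.
    have h1 : ∀ᵐ q : Space d × ℝ, q.2 ≠ 1 :=
      Measure.quasiMeasurePreserving_snd.ae (p := fun t : ℝ => t ≠ 1) (Measure.ae_ne volume 1)
    refine hi.congr ?_
    filter_upwards [ae_restrict_of_ae h1, ae_restrict_mem
      (hK.measurableSet.prod measurableSet_Icc)] with q hq hqm
    rw [margDensity_smul_margField h₀ h₁ hb (lt_of_le_of_ne hqm.2.2 hq)]
    have : q.1 ∈ Metric.closedBall (0 : Space d) (max R 0) :=
      Metric.closedBall_subset_closedBall (le_max_left _ _) (hR hqm.1)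
    simp [ballIndicator, indicator_of_mem this]
  weak_eq ψ hψ hc := weak_eq_linear h₀ h₁ hb hm (hψ.of_le (by exact_mod_cast le_top)) hc

end

/-! ### Limits at the final time. -/

section

variable {d : ℕ} {ρ₀ ρ₁ : Space d → ℝ}

/-- Substituting `y = (x - t x₁) / a` at fixed `x` trades `a⁻ᵈ`, which blows up as `a → 0`, for the
harmless `t⁻ᵈ`. -/
theorem integral_scaledDensity_mul (ρ₀ g : Space d → ℝ) {a t : ℝ} (ha : 0 < a) (ht : 0 < t)
    (x : Space d) :
    ∫ x₁, scaledDensity ρ₀ a t x₁ x * g x₁ =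
      (t ^ d)⁻¹ * ∫ y, ρ₀ y * g (t⁻¹ • (x - a • y)) := by
  have h := Measure.integral_comp_smul (volume : Measure (Space d))
    (fun u => ρ₀ (a⁻¹ • x - u) * g (t⁻¹ • (x - a • (a⁻¹ • x - u)))) (a⁻¹ * t)
  rw [integral_sub_left_eq_self (fun y => ρ₀ y * g (t⁻¹ • (x - a • y))) volume (a⁻¹ • x),
    finrank_euclideanSpace_fin, abs_of_pos (by positivity), smul_eq_mul] at h
  have e : ∀ x₁ : Space d, scaledDensity ρ₀ a t x₁ x * g x₁ =
      (a ^ d)⁻¹ * (ρ₀ (a⁻¹ • x - (a⁻¹ * t) • x₁) *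
        g (t⁻¹ • (x - a • (a⁻¹ • x - (a⁻¹ * t) • x₁)))) := fun x₁ => by
    have e1 : a⁻¹ • x - (a⁻¹ * t) • x₁ = a⁻¹ • (x - t • x₁) := by rw [smul_sub, smul_smul]
    rw [e1, smul_inv_smul₀ ha.ne', sub_sub_cancel, inv_smul_smul₀ ht.ne', scaledDensity, mul_assoc]
  simp only [e]
  rw [integral_const_mul, h, ← mul_assoc]
  congr 1
  rw [mul_pow, inv_pow]
  field_simp

variable {ι : Type*} {l : Filter ι} {a t : ι → ℝ}

/-- Dominated convergence with majorant `C ρ₀`. The general filter serves both `t → 1` and `σ → 0`.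
-/
theorem tendsto_integral_scaledDensity_of_bounded [l.IsCountablyGenerated] (h₀ : IsDensity ρ₀)
    {g : Space d → ℝ} (hg : Measurable g) {C : ℝ} (hC : ∀ x, |g x| ≤ C) {x : Space d}
    (hx : ContinuousAt g x) (ha : Tendsto a l (𝓝[>] 0)) (ht : Tendsto t l (𝓝 1)) :
    Tendsto (fun i => ∫ x₁, scaledDensity ρ₀ (a i) (t i) x₁ x * g x₁) l (𝓝 (g x)) := by
  have ha' : ∀ᶠ i in l, 0 < a i := ha.eventually self_mem_nhdsWithin
  have ht' : ∀ᶠ i in l, 0 < t i := ht.eventually (lt_mem_nhds one_pos)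
  have h : Tendsto (fun i => ((t i) ^ d)⁻¹ * ∫ y, ρ₀ y * g ((t i)⁻¹ • (x - a i • y))) l
      (𝓝 ((1 ^ d)⁻¹ * ∫ y, ρ₀ y * g x)) := by
    refine ((ht.pow d).inv₀ (by simp)).mul ?_
    refine tendsto_integral_filter_of_dominated_convergence (fun y => ρ₀ y * C)
      (.of_forall fun i => ?_) (.of_forall fun i => ae_of_all _ fun y => ?_)
      (h₀.integrable.mul_const C) (ae_of_all _ fun y => ?_)
    · exact (h₀.measurable.mul (hg.comp (by fun_prop))).aestronglyMeasurable
    · rw [norm_mul, Real.norm_of_nonneg (h₀.nonneg y)]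
      exact mul_le_mul_of_nonneg_left (hC _) (h₀.nonneg y)
    · refine Tendsto.const_mul _ (hx.tendsto.comp ?_)
      have := (ht.inv₀ one_ne_zero).smul
        ((tendsto_const_nhds (x := x)).sub ((tendsto_nhds_of_tendsto_nhdsWithin ha).smul_const y))
      simpa using this
  rw [integral_mul_const, h₀.integral_eq_one, one_pow, inv_one, one_mul, one_mul] at h
  refine h.congr' ?_
  filter_upwards [ha', ht'] with i hi hi'
  rw [integral_scaledDensity_mul ρ₀ g hi hi']

/-- With `z = x - t x₁`, one has `a⁻ᵈ ρ₀(z/a) ‖z‖ᵈ = ‖z/a‖ᵈ ρ₀(z/a)`. Away from `x`, `‖z‖` is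
bounded below while `‖z/a‖ → ∞`, so the decay hypothesis applies. -/
theorem tendstoUniformlyOn_scaledDensity (h₀ : IsDensity ρ₀)
    (hdec : Tendsto (fun y => ‖y‖ ^ d * ρ₀ y) (Bornology.cobounded (Space d)) (𝓝 0))
    (ha : Tendsto a l (𝓝[>] 0)) (ht : Tendsto t l (𝓝 1)) (x : Space d)
    {u : Set (Space d)} (hu : IsOpen u) (hx : x ∈ u) :
    TendstoUniformlyOn (fun i x₁ => scaledDensity ρ₀ (a i) (t i) x₁ x) 0 l uᶜ := by
  obtain ⟨δ, hδ, hball⟩ := Metric.isOpen_iff.1 hu x hx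
  rw [Metric.tendstoUniformlyOn_iff]
  intro ε hε
  obtain ⟨N, -, hN⟩ := hasBasis_cobounded_norm.eventually_iff.1
    (hdec.eventually (gt_mem_nhds (show 0 < ε * (δ / 2) ^ d by positivity)))
  have ha' : ∀ᶠ i in l, 0 < a i := ha.eventually self_mem_nhdsWithin
  have ht' : ∀ᶠ i in l, 0 < t i := ht.eventually (lt_mem_nhds one_pos)
  have haN : ∀ᶠ i in l, a i * N < δ / 2 := by
    have := (tendsto_nhds_of_tendsto_nhdsWithin ha).mul_const N
    rw [zero_mul] at this
    exact this.eventually (gt_mem_nhds (by positivity))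
  -- The right side bounds `‖x - t x₁‖` from below, since `t (x₁ - x) = (1 - t) x - (x - t x₁)`.
  have htd : ∀ᶠ i in l, δ / 2 < t i * δ - |1 - t i| * ‖x‖ := by
    have := (ht.mul_const δ).sub (((ht.const_sub 1).abs).mul_const ‖x‖)
    rw [sub_self, abs_zero, zero_mul, sub_zero, one_mul] at this
    exact this.eventually (lt_mem_nhds (by linarith))
  filter_upwards [ha', ht', haN, htd] with i hi hi' hiN hid x₁ hx₁
  have hdist : δ ≤ ‖x₁ - x‖ := by
    by_contra! hlt
    exact hx₁ (hball (by rwa [Metric.mem_ball, dist_eq_norm]))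
  have hfar : δ / 2 ≤ ‖x - t i • x₁‖ := by
    have e : t i • (x₁ - x) = (1 - t i) • x - (x - t i • x₁) := by module
    have h1 : ‖t i • (x₁ - x)‖ ≤ |1 - t i| * ‖x‖ + ‖x - t i • x₁‖ := by
      rw [e]
      refine (norm_sub_le _ _).trans_eq ?_
      rw [norm_smul, Real.norm_eq_abs]
    rw [norm_smul, Real.norm_of_nonneg hi'.le] at h1
    nlinarith
  set z := x - t i • x₁ with hz
  have hy : ‖(a i)⁻¹ • z‖ = (a i)⁻¹ * ‖z‖ := by
    rw [norm_smul, Real.norm_of_nonneg (by positivity)]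
  have hlarge : N ≤ ‖(a i)⁻¹ • z‖ := by
    rw [hy, le_inv_mul_iff₀ hi]; linarith
  have hsmall := hN hlarge
  rw [hy, mul_pow, inv_pow] at hsmall
  rw [Pi.zero_apply, dist_zero_left, Real.norm_of_nonneg
    (scaledDensity_nonneg h₀.nonneg hi.le _ _ _), scaledDensity, ← hz]
  have hρ := h₀.nonneg ((a i)⁻¹ • z)
  have hp : (δ / 2) ^ d ≤ ‖z‖ ^ d := by gcongr
  have hpos : 0 < (δ / 2) ^ d := by positivity
  refine lt_of_mul_lt_mul_right (lt_of_le_of_lt ?_ hsmall) hpos.le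
  calc ((a i) ^ d)⁻¹ * ρ₀ ((a i)⁻¹ • z) * (δ / 2) ^ d
      ≤ ((a i) ^ d)⁻¹ * ρ₀ ((a i)⁻¹ • z) * ‖z‖ ^ d :=
        mul_le_mul_of_nonneg_left hp (mul_nonneg (by positivity) hρ)
    _ = _ := by ring

/-- The kernels are peak functions at `x`. That their mass in the unit ball tends to `1` is the
bounded case applied to its indicator. -/
theorem tendsto_integral_scaledDensity_of_decay [l.IsCountablyGenerated] (h₀ : IsDensity ρ₀)
    (hdec : Tendsto (fun y => ‖y‖ ^ d * ρ₀ y) (Bornology.cobounded (Space d)) (𝓝 0))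
    {g : Space d → ℝ} (hg : Integrable g) {x : Space d} (hx : ContinuousAt g x)
    (ha : Tendsto a l (𝓝[>] 0)) (ht : Tendsto t l (𝓝 1)) :
    Tendsto (fun i => ∫ x₁, scaledDensity ρ₀ (a i) (t i) x₁ x * g x₁) l (𝓝 (g x)) := by
  have hball : Metric.ball x 1 ∈ 𝓝 x := Metric.ball_mem_nhds x one_pos
  refine tendsto_integral_peak_smul_of_integrable_of_tendsto
    (φ := fun i x₁ => scaledDensity ρ₀ (a i) (t i) x₁ x) measurableSet_ball hball
    measure_ball_lt_top.ne ?_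
    (fun u hu hxu => tendstoUniformlyOn_scaledDensity h₀ hdec ha ht x hu hxu) ?_
    (.of_forall fun i => (measurable_scaledDensity h₀.measurable measurable_const measurable_const
      measurable_id measurable_const).aestronglyMeasurable) hg hx.tendsto
  · filter_upwards [ha.eventually self_mem_nhdsWithin] with i hi x₁
    exact scaledDensity_nonneg h₀.nonneg (le_of_lt hi) _ _ _
  · have h1 : (Metric.ball x 1).indicator (1 : Space d → ℝ) x = 1 :=
      indicator_of_mem (Metric.mem_ball_self one_pos) _
    have hc : ContinuousAt ((Metric.ball x 1).indicator (1 : Space d → ℝ)) x := by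
      refine (continuousAt_const (y := (1 : ℝ))).congr ?_
      filter_upwards [hball] with y hy
      rw [indicator_of_mem hy, Pi.one_apply]
    have := tendsto_integral_scaledDensity_of_bounded h₀
      (measurable_one.indicator measurableSet_ball) (C := 1) (fun y => ?_) hc ha ht
    · rw [h1] at this
      refine this.congr fun i => ?_
      rw [← integral_indicator measurableSet_ball]
      congr 1; ext1 y
      by_cases hy : y ∈ Metric.ball x 1 <;> simp [indicator, hy]
    · by_cases hy : y ∈ Metric.ball x 1 <;> simp [indicator, hy]

theorem tendsto_integral_scaledDensity [l.IsCountablyGenerated] (h₀ : IsDensity ρ₀)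
    (h₁ : IsDensity ρ₁) (hc : Continuous ρ₁)
    (h : (∃ C : ℝ, ∀ x, ρ₁ x ≤ C) ∨
      Tendsto (fun y => ‖y‖ ^ d * ρ₀ y) (Bornology.cobounded (Space d)) (𝓝 0)) (x : Space d)
    (ha : Tendsto a l (𝓝[>] 0)) (ht : Tendsto t l (𝓝 1)) :
    Tendsto (fun i => ∫ x₁, scaledDensity ρ₀ (a i) (t i) x₁ x * ρ₁ x₁) l (𝓝 (ρ₁ x)) := by
  rcases h with ⟨C, hC⟩ | h
  · exact tendsto_integral_scaledDensity_of_bounded h₀ h₁.measurable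
      (fun y => (abs_of_nonneg (h₁.nonneg y)).trans_le (hC y)) hc.continuousAt ha ht
  · exact tendsto_integral_scaledDensity_of_decay h₀ h h₁.integrable hc.continuousAt ha ht

theorem tendsto_margDensity_one (h₀ : IsDensity ρ₀)
    (h₁ : IsDensity ρ₁) (hc : Continuous ρ₁)
    (h : (∃ C : ℝ, ∀ x, ρ₁ x ≤ C) ∨
      Tendsto (fun y => ‖y‖ ^ d * ρ₀ y) (Bornology.cobounded (Space d)) (𝓝 0)) (x : Space d) :
    Tendsto (fun t => margDensity (condFlow 0) ρ₀ ρ₁ x t) (𝓝[<] 1) (𝓝 (ρ₁ x)) := by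
  have ht : Tendsto (fun t : ℝ => t) (𝓝[<] 1) (𝓝 1) := nhdsWithin_le_nhds
  have ha : Tendsto (fun t : ℝ => 1 - t) (𝓝[<] 1) (𝓝[>] 0) := by
    refine tendsto_nhdsWithin_iff.2 ⟨by simpa using ht.const_sub 1, ?_⟩
    filter_upwards [self_mem_nhdsWithin] with t ht
    exact sub_pos.2 (mem_Iio.1 ht)
  refine (tendsto_integral_scaledDensity h₀ h₁ hc h x ha ht).congr' ?_
  filter_upwards [self_mem_nhdsWithin] with t ht
  rw [margDensity_condFlow_zero ρ₀ ρ₁ ht]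

theorem tendsto_margDensity_regularized (h₀ : IsDensity ρ₀)
    (h₁ : IsDensity ρ₁) (hc : Continuous ρ₁)
    (h : (∃ C : ℝ, ∀ x, ρ₁ x ≤ C) ∨
      Tendsto (fun y => ‖y‖ ^ d * ρ₀ y) (Bornology.cobounded (Space d)) (𝓝 0)) (x : Space d) :
    Tendsto (fun σ => margDensity (condFlow σ) ρ₀ ρ₁ x 1) (𝓝[>] 0) (𝓝 (ρ₁ x)) := by
  refine (tendsto_integral_scaledDensity h₀ h₁ hc h x tendsto_id tendsto_const_nhds).congr' ?_
  filter_upwards [self_mem_nhdsWithin] with σ hσ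
  rw [margDensity_condFlow ρ₀ ρ₁ (by simpa using hσ)]
  simp

end

/-! ### The classical continuity equation. -/

section

variable {d : ℕ} {ρ₀ ρ₁ : Space d → ℝ}

theorem hasDerivAt_invFlow {t : ℝ} (ht : t < 1) (x₁ x : Space d) :
    HasDerivAt (fun s : ℝ => (1 - s)⁻¹ • (x - s • x₁)) (((1 - t)⁻¹ * (1 - t)⁻¹) • (x - x₁)) t := by
  have h0 : 1 - t ≠ 0 := by linarith
  have h1 := (((hasDerivAt_id t).const_sub 1).fun_inv h0).fun_smul
    (((hasDerivAt_id t).smul_const x₁).const_sub x)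
  refine h1.congr_deriv ?_
  have e : x - x₁ = (x - t • x₁) - (1 - t) • x₁ := by module
  rw [e, smul_sub _ (x - t • x₁), smul_smul _ (1 - t), mul_assoc, inv_mul_cancel₀ h0, mul_one]
  simp only [id, one_smul, smul_neg, neg_neg, one_div, sq, mul_inv]
  module

theorem hasDerivAt_inv_pow {t : ℝ} (ht : t < 1) (d : ℕ) :
    HasDerivAt (fun s : ℝ => ((1 - s) ^ d)⁻¹) (d * (((1 - t) ^ d)⁻¹ * (1 - t)⁻¹)) t := by
  have h0 : 1 - t ≠ 0 := by linarith
  have h1 := (((hasDerivAt_id t).const_sub 1).fun_pow d).fun_inv (pow_ne_zero d h0)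
  refine h1.congr_deriv ?_
  -- The power rule has the exponent `d - 1` in `ℕ`, so `d = 0` is separate.
  cases d with
  | zero => simp
  | succ n =>
    simp only [id, Nat.add_sub_cancel]
    field_simp
    ring

theorem integrable_norm_sub_mul (h₁ : IsDensity ρ₁) (hm : Integrable (fun x => ‖x‖ * ρ₁ x))
    (x : Space d) : Integrable (fun x₁ => ‖x - x₁‖ * ρ₁ x₁) := by
  refine (integrable_smul_sub h₁ hm x).norm.congr (ae_of_all _ fun y => ?_)
  simp only [norm_smul, Real.norm_of_nonneg (h₁.nonneg y)]
  rw [mul_comm, norm_sub_rev]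

theorem hasDerivAt_margDensity (h₀ : IsDensity ρ₀) (h₁ : IsDensity ρ₁)
    (hb : ∃ C : ℝ, ∀ x, ρ₀ x ≤ C) (hm : Integrable (fun x => ‖x‖ * ρ₁ x))
    (hρ : ContDiff ℝ 1 ρ₀) (hg : ∃ C : ℝ, ∀ x, ‖fderiv ℝ ρ₀ x‖ ≤ C)
    {t : ℝ} (ht : t < 1) (x : Space d) :
    HasDerivAt (fun s => margDensity (condFlow 0) ρ₀ ρ₁ x s)
      (∫ x₁, (((1 - t) ^ d)⁻¹ * (1 - t)⁻¹) * ρ₁ x₁ * (d * ρ₀ ((1 - t)⁻¹ • (x - t • x₁)) +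
        (1 - t)⁻¹ * fderiv ℝ ρ₀ ((1 - t)⁻¹ • (x - t • x₁)) (x - x₁))) t := by
  obtain ⟨C, hC⟩ := hg
  have ha : 0 < 1 - t := sub_pos.2 ht
  have hC0 : 0 ≤ C := (norm_nonneg _).trans (hC 0)
  have hfc := hρ.continuous_fderiv one_ne_zero
  have hint : ∀ s : ℝ, s < 1 → Integrable fun x₁ => ρ₀ ((1 - s)⁻¹ • (x - s • x₁)) * ρ₁ x₁ := fun s hs => by
    have h0 : 0 < 1 - s := sub_pos.2 hs
    refine ((integrable_scaledDensity_smul h₀ hb h₁.integrable h0.le s x).const_mul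
      ((1 - s) ^ d)).congr (ae_of_all _ fun x₁ => ?_)
    simp only [scaledDensity, smul_eq_mul]
    field_simp
  have hcz : Continuous fun x₁ : Space d => (1 - t)⁻¹ • (x - t • x₁) := by fun_prop
  have hI := hasDerivAt_integral_of_dominated_loc_of_deriv_le (μ := (volume : Measure (Space d)))
    (F := fun s x₁ => ρ₀ ((1 - s)⁻¹ • (x - s • x₁)) * ρ₁ x₁)
    (F' := fun s x₁ => fderiv ℝ ρ₀ ((1 - s)⁻¹ • (x - s • x₁))
      (((1 - s)⁻¹ * (1 - s)⁻¹) • (x - x₁)) * ρ₁ x₁) (x₀ := t)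
    -- On the neighbourhood `s < (1 + t) / 2` one has `1 - s ≥ (1 - t) / 2`, which gives the
    -- constant.
    (bound := fun x₁ => C * (((1 - t) / 2)⁻¹ * ((1 - t) / 2)⁻¹) * (‖x - x₁‖ * ρ₁ x₁))
    (Iio_mem_nhds (show t < (1 + t) / 2 by linarith))
    ?_ (hint t ht) ?_ (ae_of_all _ fun x₁ s hs => ?_)
    ((integrable_norm_sub_mul h₁ hm x).const_mul _) (ae_of_all _ fun x₁ s hs => ?_)
  · have hP := (hasDerivAt_inv_pow ht d).mul hI.2
    refine (hP.congr_of_eventuallyEq ?_).congr_deriv ?_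
    · filter_upwards [Iio_mem_nhds ht] with s hs
      rw [margDensity_condFlow_zero ρ₀ ρ₁ hs, Pi.mul_apply, ← integral_const_mul]
      simp only [scaledDensity, mul_assoc]
    · rw [← integral_const_mul, ← integral_const_mul, ← integral_add]
      · congr 1; ext1 x₁
        simp only [map_smul, smul_eq_mul]
        ring
      · exact (hint t ht).const_mul _
      · exact hI.1.const_mul _
  · filter_upwards [Iio_mem_nhds ht] with s hs
    exact (hint s hs).1
  · exact (((hfc.comp hcz).clm_apply (by fun_prop)).measurable.mul
      h₁.measurable).aestronglyMeasurable
  · have hs' : (1 - t) / 2 ≤ 1 - s := by linarith [mem_Iio.1 hs]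
    have hs0 : 0 < (1 - t) / 2 := by linarith
    have hs1 : 0 < 1 - s := hs0.trans_le hs'
    have hinv : (1 - s)⁻¹ ≤ ((1 - t) / 2)⁻¹ := inv_anti₀ hs0 hs'
    have hsn : 0 ≤ (1 - s)⁻¹ := by positivity
    rw [norm_mul, Real.norm_of_nonneg (h₁.nonneg x₁), ← mul_assoc]
    refine mul_le_mul_of_nonneg_right ?_ (h₁.nonneg x₁)
    refine ((fderiv ℝ ρ₀ _).le_opNorm _).trans ?_
    rw [norm_smul, Real.norm_of_nonneg (mul_nonneg hsn hsn), mul_assoc C]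
    refine mul_le_mul (hC _) ?_ (by positivity) hC0
    gcongr
  · have hs1 : s < 1 := by linarith [mem_Iio.1 hs]
    exact ((hρ.differentiable one_ne_zero _).hasFDerivAt.comp_hasDerivAt s
      (hasDerivAt_invFlow hs1 x₁ x)).mul_const _

/-- The trace, as a continuous linear map. -/
noncomputable def traceCLM (d : ℕ) : (Space d →L[ℝ] Space d) →L[ℝ] ℝ :=
  LinearMap.toContinuousLinearMap
    ((LinearMap.trace ℝ (Space d)).comp (ContinuousLinearMap.coeLM ℝ))

theorem divergence_eq_traceCLM {F : Space d → Space d} {x : Space d} :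
    divergence F x = traceCLM d (fderiv ℝ F x) := rfl

/-- In the derivative of the integrand, `-id` has trace `-d` and the rank-one term has trace `Dρ₀(x₁
- x) / (1 - t)`. The result is minus the derivative in `hasDerivAt_margDensity`. -/
theorem hasFDerivAt_linearFlux (h₀ : IsDensity ρ₀) (h₁ : IsDensity ρ₁)
    (hb : ∃ C : ℝ, ∀ x, ρ₀ x ≤ C) (hm : Integrable (fun x => ‖x‖ * ρ₁ x))
    (hρ : ContDiff ℝ 1 ρ₀) (hg : ∃ C : ℝ, ∀ x, ‖fderiv ℝ ρ₀ x‖ ≤ C)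
    {t : ℝ} (ht : t < 1) (x : Space d) :
    ∃ L : Space d →L[ℝ] Space d, HasFDerivAt (fun y => linearFlux ρ₀ ρ₁ y t) L x ∧
      traceCLM d L = -∫ x₁, (((1 - t) ^ d)⁻¹ * (1 - t)⁻¹) * ρ₁ x₁ *
        (d * ρ₀ ((1 - t)⁻¹ • (x - t • x₁)) +
        (1 - t)⁻¹ * fderiv ℝ ρ₀ ((1 - t)⁻¹ • (x - t • x₁)) (x - x₁)) := by
  have hb' := hb
  obtain ⟨B, hB⟩ := hb
  obtain ⟨C, hC⟩ := hg
  have ha : 0 < 1 - t := sub_pos.2 ht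
  have hC0 : 0 ≤ C := (norm_nonneg _).trans (hC 0)
  have hfc := hρ.continuous_fderiv one_ne_zero
  set c : ℝ := ((1 - t) ^ d)⁻¹ * (1 - t)⁻¹ with hc
  have hc0 : 0 ≤ c := by positivity
  let F' : Space d → Space d → (Space d →L[ℝ] Space d) := fun y x₁ =>
    (c * ρ₁ x₁) • (ρ₀ ((1 - t)⁻¹ • (y - t • x₁)) • (-ContinuousLinearMap.id ℝ (Space d)) +
      ((fderiv ℝ ρ₀ ((1 - t)⁻¹ • (y - t • x₁))).comp
        ((1 - t)⁻¹ • ContinuousLinearMap.id ℝ (Space d))).smulRight (x₁ - y))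
  have hflux : ∀ y, linearFlux ρ₀ ρ₁ y t =
      ∫ x₁, (c * ρ₁ x₁) • ρ₀ ((1 - t)⁻¹ • (y - t • x₁)) • (x₁ - y) := fun y => by
    rw [linearFlux]
    congr 1; ext1 x₁
    simp only [scaledDensity, smul_smul, hc]
    congr 1; ring
  have hcz : ∀ y, Continuous fun x₁ : Space d => (1 - t)⁻¹ • (y - t • x₁) := fun y => by fun_prop
  have hmeas : ∀ y, AEStronglyMeasurable
      (fun x₁ => (c * ρ₁ x₁) • ρ₀ ((1 - t)⁻¹ • (y - t • x₁)) • (x₁ - y)) := fun y =>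
    ((h₁.measurable.const_mul c).smul ((h₀.measurable.comp (hcz y).measurable).smul
      (by fun_prop))).aestronglyMeasurable
  have hF'meas : AEStronglyMeasurable (F' x) := by
    have hcont : Continuous fun x₁ : Space d =>
        ρ₀ ((1 - t)⁻¹ • (x - t • x₁)) • (-ContinuousLinearMap.id ℝ (Space d)) +
        ((fderiv ℝ ρ₀ ((1 - t)⁻¹ • (x - t • x₁))).comp
          ((1 - t)⁻¹ • ContinuousLinearMap.id ℝ (Space d))).smulRight (x₁ - x) := by
      refine ((hρ.continuous.comp (hcz x)).smul continuous_const).add ?_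
      exact (((ContinuousLinearMap.smulRightL ℝ (Space d) (Space d)).continuous.comp
        ((hfc.comp (hcz x)).clm_comp continuous_const)).clm_apply (by fun_prop))
    exact ((h₁.measurable.const_mul c).aestronglyMeasurable).smul hcont.aestronglyMeasurable
  -- For `y` in the unit ball about `x`, `‖x₁ - y‖ ≤ ‖x - x₁‖ + 1`, so the first moment of `ρ₁`
  -- dominates.
  have hbound : ∀ x₁, ∀ y ∈ Metric.ball x 1, ‖F' y x₁‖ ≤
      c * (B + C * (1 - t)⁻¹) * ρ₁ x₁ + c * (C * (1 - t)⁻¹) * (‖x - x₁‖ * ρ₁ x₁) := by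
    intro x₁ y hy
    have hρ₁ := h₁.nonneg x₁
    have hd : ‖x₁ - y‖ ≤ ‖x - x₁‖ + 1 := by
      have h1 : x₁ - y = (x₁ - x) - (y - x) := by abel
      have h2 : ‖y - x‖ < 1 := by rwa [← dist_eq_norm]
      rw [h1, norm_sub_rev x x₁]
      linarith [norm_sub_le (x₁ - x) (y - x)]
    have hid : ‖ContinuousLinearMap.id ℝ (Space d)‖ ≤ 1 := ContinuousLinearMap.norm_id_le
    have n1 : ‖ρ₀ ((1 - t)⁻¹ • (y - t • x₁)) • (-ContinuousLinearMap.id ℝ (Space d))‖ ≤ B := by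
      rw [norm_smul, norm_neg, Real.norm_of_nonneg (h₀.nonneg _)]
      exact (mul_le_of_le_one_right (h₀.nonneg _) hid).trans (hB _)
    have n2 : ‖((fderiv ℝ ρ₀ ((1 - t)⁻¹ • (y - t • x₁))).comp
        ((1 - t)⁻¹ • ContinuousLinearMap.id ℝ (Space d))).smulRight (x₁ - y)‖ ≤
        C * (1 - t)⁻¹ * (‖x - x₁‖ + 1) := by
      rw [ContinuousLinearMap.norm_smulRight_apply]
      refine mul_le_mul ((ContinuousLinearMap.opNorm_comp_le _ _).trans ?_) hd (norm_nonneg _)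
        (by positivity)
      refine mul_le_mul (hC _) ?_ (norm_nonneg _) hC0
      rw [norm_smul, Real.norm_of_nonneg (by positivity)]
      exact mul_le_of_le_one_right (by positivity) hid
    simp only [F']
    rw [norm_smul, Real.norm_of_nonneg (mul_nonneg hc0 hρ₁)]
    refine (mul_le_mul_of_nonneg_left ((norm_add_le _ _).trans (add_le_add n1 n2))
      (mul_nonneg hc0 hρ₁)).trans_eq ?_
    ring
  have hbint : Integrable fun x₁ =>
      c * (B + C * (1 - t)⁻¹) * ρ₁ x₁ + c * (C * (1 - t)⁻¹) * (‖x - x₁‖ * ρ₁ x₁) :=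
    (h₁.integrable.const_mul _).add ((integrable_norm_sub_mul h₁ hm x).const_mul _)
  have hFint : Integrable (F' x) := hbint.mono' hF'meas
    (ae_of_all _ fun x₁ => hbound x₁ x (Metric.mem_ball_self one_pos))
  refine ⟨∫ x₁, F' x x₁, ?_, ?_⟩
  · simp only [hflux]
    refine hasFDerivAt_integral_of_dominated_of_fderiv_le (Metric.ball_mem_nhds x one_pos)
      (.of_forall hmeas) ?_ hF'meas (ae_of_all _ hbound) hbint
      (ae_of_all _ fun x₁ y _ => ?_)
    · refine ((integrable_scaledDensity_smul h₀ hb' (integrable_smul_sub h₁ hm x) ha.le t x).smul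
        (1 - t)⁻¹).congr (ae_of_all _ fun x₁ => ?_)
      simp only [Pi.smul_apply, smul_smul, scaledDensity, hc]
      congr 1; ring
    · have hz : HasFDerivAt (fun y : Space d => (1 - t)⁻¹ • (y - t • x₁))
          ((1 - t)⁻¹ • ContinuousLinearMap.id ℝ (Space d)) y :=
        ((hasFDerivAt_id y).sub_const (t • x₁)).const_smul (1 - t)⁻¹
      exact (((hρ.differentiable one_ne_zero _).hasFDerivAt.comp y hz).smul
        ((hasFDerivAt_id y).const_sub x₁)).const_smul (c * ρ₁ x₁)
  · rw [← ContinuousLinearMap.integral_comp_comm _ hFint, ← integral_neg]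
    congr 1; ext1 x₁
    have e1 : traceCLM d (ContinuousLinearMap.id ℝ (Space d)) = d := by
      have := LinearMap.trace_id ℝ (Space d)
      rw [finrank_euclideanSpace_fin] at this
      exact this
    have e2 : ∀ (f : Space d →L[ℝ] ℝ) (v : Space d), traceCLM d (f.smulRight v) = f v :=
      fun f v => LinearMap.trace_smulRight (f : Space d →ₗ[ℝ] ℝ) v
    have e3 : x₁ - x = -(x - x₁) := by abel
    simp only [F', map_smul, map_add, map_neg, e1, e2, e3]
    simp
    ring

theorem solvesContinuityEquation_linear (h₀ : IsDensity ρ₀) (h₁ : IsDensity ρ₁)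
    (hb : ∃ C : ℝ, ∀ x, ρ₀ x ≤ C) (hm : Integrable (fun x => ‖x‖ * ρ₁ x))
    (hρ : ContDiff ℝ 1 ρ₀) (hg : ∃ C : ℝ, ∀ x, ‖fderiv ℝ ρ₀ x‖ ≤ C) :
    SolvesContinuityEquation (margDensity (condFlow 0) ρ₀ ρ₁)
      (margField (condFlow 0) ρ₀ ρ₁) := by
  intro x t ht
  obtain ⟨L, hL, htr⟩ := hasFDerivAt_linearFlux h₀ h₁ hb hm hρ hg ht.2 x
  simp only [margDensity_smul_margField h₀ h₁ hb ht.2]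
  refine ⟨hL.differentiableAt, ?_⟩
  rw [divergence_eq_traceCLM, hL.fderiv, htr, neg_neg]
  exact hasDerivAt_margDensity h₀ h₁ hb hm hρ hg ht.2 x

/-- The derivative formula holds for all `t < 1`, negative `t` included, so `t = 0` is an interior
point. -/
theorem tendsto_margDensity_zero (h₀ : IsDensity ρ₀) (h₁ : IsDensity ρ₁)
    (hb : ∃ C : ℝ, ∀ x, ρ₀ x ≤ C) (hm : Integrable (fun x => ‖x‖ * ρ₁ x))
    (hρ : ContDiff ℝ 1 ρ₀) (hg : ∃ C : ℝ, ∀ x, ‖fderiv ℝ ρ₀ x‖ ≤ C) (x : Space d) :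
    Tendsto (fun t => margDensity (condFlow 0) ρ₀ ρ₁ x t) (𝓝[>] 0) (𝓝 (ρ₀ x)) := by
  have := (hasDerivAt_margDensity h₀ h₁ hb hm hρ hg one_pos x).continuousAt.tendsto
  rw [margDensity_zero h₁] at this
  exact this.mono_left nhdsWithin_le_nhds

end

/-- The two fields agree for `t < 1`, the time `t = 1` is null, and `0 ^ p = 0` because `p > 0`. -/
theorem flowMatchingObjective_explicitField {d : ℕ} (ρ₀ ρ₁ : Space d → ℝ) {p : ℝ} (hp : 0 < p) :
    flowMatchingObjective p (margDensity (condFlow 0) ρ₀ ρ₁) (margField (condFlow 0) ρ₀ ρ₁)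
      (explicitField ρ₀ ρ₁) = 0 := by
  rw [flowMatchingObjective, Measure.restrict_congr_set Ico_ae_eq_Icc.symm]
  refine (setLIntegral_congr_fun (g := fun _ => 0) measurableSet_Ico fun t ht => ?_).trans
    lintegral_zero
  simp [explicitField_eq_margField ρ₀ ρ₁ ht.2, hp]

end ExFM

theorem mainTheorem7 (d : ℕ) (ρ₀ ρ₁ : ExFM.Space d → ℝ)
    (h₀ : ExFM.IsDensity ρ₀) (h₁ : ExFM.IsDensity ρ₁)
    (hbdd₀ : ∃ C : ℝ, ∀ x, ρ₀ x ≤ C)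
    (hcont₁ : Continuous ρ₁)
    (hmom₁ : Integrable (fun x => ‖x‖ * ρ₁ x)) :
    -- the marginal path of the linear conditional flow consists of probability densities
    (∀ t ∈ Ico (0 : ℝ) 1,
      ExFM.IsDensity (fun x => ExFM.margDensity (ExFM.condFlow 0) ρ₀ ρ₁ x t)) ∧
    -- together with the marginal vector field it solves the boundary value problem
    ExFM.IsWeakSolution (ExFM.margDensity (ExFM.condFlow 0) ρ₀ ρ₁)
      (ExFM.margField (ExFM.condFlow 0) ρ₀ ρ₁) ρ₀ ρ₁ ∧
    (∀ x, ExFM.margDensity (ExFM.condFlow 0) ρ₀ ρ₁ x 0 = ρ₀ x) ∧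
    -- classically, if the initial density is regular
    (ContDiff ℝ 1 ρ₀ → (∃ C : ℝ, ∀ x, ‖fderiv ℝ ρ₀ x‖ ≤ C) →
      ExFM.SolvesContinuityEquation (ExFM.margDensity (ExFM.condFlow 0) ρ₀ ρ₁)
        (ExFM.margField (ExFM.condFlow 0) ρ₀ ρ₁) ∧
      ∀ x, Tendsto (fun t => ExFM.margDensity (ExFM.condFlow 0) ρ₀ ρ₁ x t) (𝓝[>] 0)
        (𝓝 (ρ₀ x))) ∧
    -- the final density is hit pointwise, by the path itself as `t → 1` and by the
    -- regularized path at `t = 1` as `σ → 0`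
    (((∃ C : ℝ, ∀ x, ρ₁ x ≤ C) ∨
        Tendsto (fun y => ‖y‖ ^ d * ρ₀ y) (Bornology.cobounded (ExFM.Space d)) (𝓝 0)) →
      ∀ x,
        Tendsto (fun t => ExFM.margDensity (ExFM.condFlow 0) ρ₀ ρ₁ x t) (𝓝[<] 1)
          (𝓝 (ρ₁ x)) ∧
        Tendsto (fun σ => ExFM.margDensity (ExFM.condFlow σ) ρ₀ ρ₁ x 1) (𝓝[>] 0)
          (𝓝 (ρ₁ x))) ∧
    -- the explicit field is the marginal field, and it minimizes the Flow Matching objective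
    (∀ x, ∀ t ∈ Ico (0 : ℝ) 1,
      ExFM.explicitField ρ₀ ρ₁ x t = ExFM.margField (ExFM.condFlow 0) ρ₀ ρ₁ x t) ∧
    ∀ p : ℝ, 0 < p →
      IsMinOn
        (ExFM.flowMatchingObjective p (ExFM.margDensity (ExFM.condFlow 0) ρ₀ ρ₁)
          (ExFM.margField (ExFM.condFlow 0) ρ₀ ρ₁))
        univ (ExFM.explicitField ρ₀ ρ₁) ∧
      ExFM.flowMatchingObjective p (ExFM.margDensity (ExFM.condFlow 0) ρ₀ ρ₁)
        (ExFM.margField (ExFM.condFlow 0) ρ₀ ρ₁) (ExFM.explicitField ρ₀ ρ₁) = 0 := by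
  refine ⟨fun t ht => ExFM.isDensity_margDensity h₀ h₁ ht.2,
    ExFM.isWeakSolution_linear h₀ h₁ hbdd₀ hmom₁, ExFM.margDensity_zero h₁,
    fun hρ hg => ⟨ExFM.solvesContinuityEquation_linear h₀ h₁ hbdd₀ hmom₁ hρ hg,
      ExFM.tendsto_margDensity_zero h₀ h₁ hbdd₀ hmom₁ hρ hg⟩,
    fun h x => ⟨ExFM.tendsto_margDensity_one h₀ h₁ hcont₁ h x,
      ExFM.tendsto_margDensity_regularized h₀ h₁ hcont₁ h x⟩,
    fun x t ht => ExFM.explicitField_eq_margField ρ₀ ρ₁ ht.2 x, fun p hp => ?_⟩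
  have h := ExFM.flowMatchingObjective_explicitField ρ₀ ρ₁ hp
  exact ⟨isMinOn_iff.2 fun u _ => by simp only [h, zero_le], h⟩
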